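/- All graphs are finite and simple. A graph is locally irregular if any two adjacent vertices have distinct degrees. A locally irregular edge-coloring of a graph $G$ is a (not necessarily proper) edge-coloring of $G$ such that, for every color, the graph induced on the edges of that color is locally irregular. A graph is decomposable if it admits a locally irregular edge-coloring; for a decomposable graph $G$, the locally irregular chromatic index $\chi'_{\mathrm{irr}}(G)$ is the smallest number of colors in a locally irregular edge-coloring of $G$. **Theorem.** Let $G$ be a decomposable subcubic graph (that is, a decomposable graph of maximum degree at most $3$). Then $G$ admits a locally irregular edge-coloring with at most $4$ colors; that is, $\chi'_{\mathrm{irr}}(G) \le 4$. -/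

import Mathlib

namespace SimpleGraph

variable {V : Type*}

open Classical in
/-- A (finite) graph is locally irregular if every two adjacent vertices have distinct degrees. -/
def IsLocallyIrregular [Fintype V] (G : SimpleGraph V) : Prop :=
  ∀ ⦃u v : V⦄, G.Adj u v → G.degree u ≠ G.degree v

/-- An arbitrary (not necessarily proper) edge-coloring `c` of `G` is locally irregular if
the subgraph formed by the edges of each color is locally irregular. This subgraph is taken on
all of `V`; the isolated vertices impose no condition and affect no degree. -/
def EdgeLabeling.IsLocallyIrregular [Fintype V] {G : SimpleGraph V} {K : Type*}
    (c : G.EdgeLabeling K) : Prop :=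
  ∀ k : K, (c.labelGraph k).IsLocallyIrregular

/-- `G` admits a locally irregular edge-coloring with (at most) `k` colors. -/
def LocallyIrregularColorable [Fintype V] (G : SimpleGraph V) (k : ℕ) : Prop :=
  ∃ c : G.EdgeLabeling (Fin k), c.IsLocallyIrregular

/-- `G` is decomposable if it admits a locally irregular edge-coloring with some number of
colors. -/
def IsDecomposable [Fintype V] (G : SimpleGraph V) : Prop :=
  ∃ k : ℕ, G.LocallyIrregularColorable k

/-- The locally irregular chromatic index: the least number of colors in a locally irregular
edge-coloring of `G` (and `⊤` if there is none). -/
noncomputable def locallyIrregularChromaticIndex [Fintype V] (G : SimpleGraph V) : ℕ∞ :=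
  ⨅ k ∈ {k : ℕ | G.LocallyIrregularColorable k}, (k : ℕ∞)

end SimpleGraph

/-! Orient the edges and give all arcs leaving a vertex one colour. An out-star with at least two
arcs is locally irregular, and vertex-disjoint out-stars may share a colour, so it mostly suffices
that out-stars that meet get different colours. Only a rigid core of tails resists a greedy choice
among four colours, and it is coloured by hand.

Suppose first that all out-degrees are 0 or 2. Remove in turn a tail meeting at most three remaining
ones, or an arc `p → c` whose two ends can be put back together (`extends_insert`,
`extends_insert_pair`). In the core that is left, counting meetings shows that no arc joins two
tails and that every tail points to two sinks with all three in-neighbours in the core. The core is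
thus bipartite with degrees 2 and 3, so one colour serves for it, and the removed tails are coloured
in reverse order.

In general some out-degrees are odd. Decomposability enters in `exists_goodOrientation`: a locally
irregular decomposition yields an orientation in which every vertex of odd out-degree either has
out-degree 3 or is the centre of a certain five-edge tree. Reversing a walk between two odd vertices
makes both even. Done for a closest pair, or for the two out-neighbours of one vertex, this
preserves the property, so each component may be assumed to have at most one odd vertex.

If that vertex is a spider centre, reversing one or two arcs produces a vertex of out-degree 3,
unless the three ends of the spider are sinks, and then the spider joins the core. If it is a vertex
`x` of out-degree 3, a core vertex other than `x` with a child in the core must be a child of `x`,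
so little of the core is irregular. When `x` lies in the core, a cherry or a spider is cut out so
that the rest of the core fits in colour 0 (`of_hole`). The cut-out piece touches the out-stars of
at most two tails outside the core, so after the extension a nonzero colour is free for it; hence
extensions must tolerate deleted core arcs. If `x` has a child in the core but too few sink
children, arcs are reversed to move the centre to a core vertex that has two (`of_claw`). -/

open scoped Classical in
/-- The vertices joined to `v` by `R` in some direction. -/
noncomputable def arcNeighbors {V : Type*} [Fintype V] (R : V → V → Prop) (v : V) : Finset V :=
  {w | R v w ∨ R w v}

open scoped Classical in
/-- The out-neighbours of `v`. -/
noncomputable def outN {V : Type*} [Fintype V] (R : V → V → Prop) (v : V) : Finset V :=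
  {w | R v w}

open scoped Classical in
/-- The in-neighbours of `v`. -/
noncomputable def inN {V : Type*} [Fintype V] (R : V → V → Prop) (v : V) : Finset V :=
  {w | R w v}

/-- The graph underlying the relation `R` is locally irregular. -/
def ArcIrregular {V : Type*} [Fintype V] (R : V → V → Prop) : Prop :=
  ∀ ⦃u v⦄, R u v → (arcNeighbors R u).card ≠ (arcNeighbors R v).card

/-! ### Locally irregular pieces: stars, cherries, spiders, double stars -/

section Irregular

open scoped Classical

variable {V : Type*} [Fintype V] {R S : V → V → Prop} {u v w : V}

@[simp] theorem mem_arcNeighbors : w ∈ arcNeighbors R v ↔ R v w ∨ R w v := by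
  simp [arcNeighbors]

@[simp] theorem mem_outN : w ∈ outN R v ↔ R v w := by simp [outN]

@[simp] theorem mem_inN : w ∈ inN R v ↔ R w v := by simp [inN]

theorem card_arcNeighbors (h : ∀ u v, R u v → ¬ R v u) (v : V) :
    (arcNeighbors R v).card = (outN R v).card + (inN R v).card := by
  rw [← Finset.card_union_of_disjoint]
  · congr 1; ext w; simp
  · rw [Finset.disjoint_left]; intro w; simpa using h v w

theorem ArcIrregular.congr (hR : ArcIrregular R) (h : ∀ u v, (R u v ∨ R v u) ↔ (S u v ∨ S v u)) :
    ArcIrregular S := by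
  have e : ∀ v, arcNeighbors S v = arcNeighbors R v := by intro v; ext w; simp [h]
  intro u v huv
  rw [e, e]
  rcases (h u v).2 (Or.inl huv) with h1 | h1
  · exact hR h1
  · exact (hR h1).symm

theorem ArcIrregular.union (hR : ArcIrregular R) (hS : ArcIrregular S)
    (h : ∀ u v w, (R u v ∨ R v u) → ¬ (S u w ∨ S w u)) :
    ArcIrregular (fun u v => R u v ∨ S u v) := by
  have eR : ∀ v w, (R v w ∨ R w v) → arcNeighbors (fun u v => R u v ∨ S u v) v = arcNeighbors R v := by
    intro v w hvw; ext z
    have := h v w z hvw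
    simp only [mem_arcNeighbors]; tauto
  have eS : ∀ v w, (S v w ∨ S w v) → arcNeighbors (fun u v => R u v ∨ S u v) v = arcNeighbors S v := by
    intro v w hvw; ext z
    have := h v z w
    simp only [mem_arcNeighbors]; tauto
  rintro u v (huv | huv)
  · rw [eR u v (Or.inl huv), eR v u (Or.inr huv)]; exact hR huv
  · rw [eS u v (Or.inl huv), eS v u (Or.inr huv)]; exact hS huv

theorem ArcIrregular.of_false (h : ∀ u v, ¬ R u v) : ArcIrregular R :=
  fun u v huv => absurd huv (h u v)

theorem arcIrregular_star {O : V → V → Prop} {c : V} (hc : ¬ O c c) (h : 2 ≤ (outN O c).card) :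
    ArcIrregular (fun u v => u = c ∧ O u v) := by
  rintro u v ⟨rfl, huv⟩
  have e1 : arcNeighbors (fun a b => a = u ∧ O a b) u = outN O u := by
    ext w; simp only [mem_arcNeighbors, mem_outN]
    constructor
    · rintro (h | ⟨rfl, h⟩)
      · exact h.2
      · exact h
    · intro h; exact Or.inl ⟨trivial, h⟩
  have e2 : arcNeighbors (fun a b => a = u ∧ O a b) v = {u} := by
    ext w; simp only [mem_arcNeighbors, Finset.mem_singleton]
    constructor
    · rintro (⟨rfl, h⟩ | h)
      · exact absurd huv hc
      · exact h.1
    · rintro rfl; exact Or.inr ⟨rfl, huv⟩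
  rw [e1, e2, Finset.card_singleton]; omega

theorem arcIrregular_cherry {a x d : V} (h1 : a ≠ x) (h2 : a ≠ d) (h3 : x ≠ d) :
    ArcIrregular (fun u v => (u = a ∧ v = x) ∨ (u = a ∧ v = d)) := by
  have e1 : arcNeighbors (fun u v => (u = a ∧ v = x) ∨ (u = a ∧ v = d)) a = {x, d} := by
    ext w; simp; grind
  have e2 : arcNeighbors (fun u v => (u = a ∧ v = x) ∨ (u = a ∧ v = d)) x = {a} := by
    ext w; simp; grind
  have e3 : arcNeighbors (fun u v => (u = a ∧ v = x) ∨ (u = a ∧ v = d)) d = {a} := by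
    ext w; simp; grind
  rintro u v (⟨rfl, rfl⟩ | ⟨rfl, rfl⟩)
  · rw [e1, e2, Finset.card_pair h3]; simp
  · rw [e1, e3, Finset.card_pair h3]; simp

/-- The tree on six vertices obtained from a claw by subdividing two of its edges. -/
def Spider (r a v₁ w₁ v₂ w₂ : V) (x y : V) : Prop :=
  (x = r ∧ (y = a ∨ y = v₁ ∨ y = v₂)) ∨ (x = v₁ ∧ y = w₁) ∨ (x = v₂ ∧ y = w₂)

theorem arcIrregular_spider {r a v₁ w₁ v₂ w₂ : V} (h : [r, a, v₁, w₁, v₂, w₂].Nodup) :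
    ArcIrregular (Spider r a v₁ w₁ v₂ w₂) := by
  have h' : r ≠ a ∧ r ≠ v₁ ∧ r ≠ w₁ ∧ r ≠ v₂ ∧ r ≠ w₂ ∧ a ≠ v₁ ∧ a ≠ w₁ ∧ a ≠ v₂ ∧ a ≠ w₂ ∧
      v₁ ≠ w₁ ∧ v₁ ≠ v₂ ∧ v₁ ≠ w₂ ∧ w₁ ≠ v₂ ∧ w₁ ≠ w₂ ∧ v₂ ≠ w₂ := by
    simp at h; tauto
  obtain ⟨_, _, _, _, _, _, _, _, _, _, _, _, _, _, _⟩ := h'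
  have e1 : (arcNeighbors (Spider r a v₁ w₁ v₂ w₂) r).card = 3 := by
    rw [Finset.card_eq_three]
    refine ⟨a, v₁, v₂, by assumption, by assumption, by assumption, ?_⟩
    ext w; simp [Spider]; grind
  have e2 : (arcNeighbors (Spider r a v₁ w₁ v₂ w₂) a).card = 1 := by
    rw [Finset.card_eq_one]; refine ⟨r, ?_⟩
    ext w; simp [Spider]; grind
  have e3 : (arcNeighbors (Spider r a v₁ w₁ v₂ w₂) w₁).card = 1 := by
    rw [Finset.card_eq_one]; refine ⟨v₁, ?_⟩
    ext w; simp [Spider]; grind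
  have e4 : (arcNeighbors (Spider r a v₁ w₁ v₂ w₂) w₂).card = 1 := by
    rw [Finset.card_eq_one]; refine ⟨v₂, ?_⟩
    ext w; simp [Spider]; grind
  have e5 : (arcNeighbors (Spider r a v₁ w₁ v₂ w₂) v₁).card = 2 := by
    rw [Finset.card_eq_two]; refine ⟨r, w₁, by assumption, ?_⟩
    ext w; simp [Spider]; grind
  have e6 : (arcNeighbors (Spider r a v₁ w₁ v₂ w₂) v₂).card = 2 := by
    rw [Finset.card_eq_two]; refine ⟨r, w₂, by assumption, ?_⟩
    ext w; simp [Spider]; grind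
  rintro u v (⟨rfl, rfl | rfl | rfl⟩ | ⟨rfl, rfl⟩ | ⟨rfl, rfl⟩) <;> omega

/-- The arc `p → c` raises the degree of `c` to 3 while `p` keeps 2. All other vertices are leaves,
because the two stars share no head. -/
theorem arcIrregular_twoStars {O : V → V → Prop} {p c : V} (hO : ∀ u v, O u v → ¬ O v u)
    (hpc : O p c) (hp : (outN O p).card = 2) (hc : (outN O c).card = 2)
    (h : ∀ s, O p s → ¬ O c s) : ArcIrregular (fun u v => (u = p ∨ u = c) ∧ O u v) := by
  have hcp := hO _ _ hpc
  have hpp : ¬ O p p := fun h => hO _ _ h h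
  have hcc : ¬ O c c := fun h => hO _ _ h h
  have ep : arcNeighbors (fun u v => (u = p ∨ u = c) ∧ O u v) p = outN O p := by
    ext w; simp; grind
  have ec : arcNeighbors (fun u v => (u = p ∨ u = c) ∧ O u v) c = insert p (outN O c) := by
    ext w; simp; grind
  have e1 : ∀ s, s ≠ c → O p s →
      arcNeighbors (fun u v => (u = p ∨ u = c) ∧ O u v) s = {p} := by
    intro s hs h1; ext w; simp; grind
  have e2 : ∀ s, O c s → arcNeighbors (fun u v => (u = p ∨ u = c) ∧ O u v) s = {c} := by
    intro s h1; ext w; simp; grind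
  have hc3 : (insert p (outN O c)).card = 3 := by
    rw [Finset.card_insert_of_notMem (by simpa using hcp), hc]
  rintro u v ⟨rfl | rfl, huv⟩
  · by_cases hv : v = c
    · subst hv; rw [ep, ec, hp, hc3]; simp
    · rw [ep, e1 v hv huv, hp]; simp
  · rw [ec, e2 v huv, hc3]; simp

end Irregular

/-! ### Greedy extension of colourings and existence of cores -/

section Extension

open scoped Classical

variable {V : Type*} [Fintype V] {O O' : V → V → Prop} {W W₀ W₁ : Finset V}

/-- An orientation of a simple graph of maximum degree at most three. -/
structure SubcubicOrientation (O : V → V → Prop) : Prop where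
  asymm : ∀ u v, O u v → ¬ O v u
  degree_le : ∀ v, (outN O v).card + (inN O v).card ≤ 3

/-- The vertices `u ∈ W` other than `c` whose out-star shares a vertex with that of `c`. -/
noncomputable def meeting (O : V → V → Prop) (W : Finset V) (c : V) : Finset V :=
  {u ∈ W | u ≠ c ∧ (O u c ∨ O c u ∨ ∃ s, O c s ∧ O u s)}

/-- Colouring each arc with tail `u ∈ W` by `κ u` yields locally irregular colour classes. -/
def ValidOn (O : V → V → Prop) (W : Finset V) (κ : V → Fin 4) : Prop :=
  ∀ k, ArcIrregular (fun u v => O u v ∧ u ∈ W ∧ κ u = k)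

/-- Valid colourings on `W₀` extend to `W`, even after deleting arcs with tail in `W₀`. -/
def Extends (O : V → V → Prop) (W₀ W : Finset V) : Prop :=
  ∀ O' : V → V → Prop, (∀ u v, O' u v → O u v) → (∀ u, u ∉ W₀ → ∀ v, O u v → O' u v) →
    ∀ κ₀, ValidOn O' W₀ κ₀ → ∃ κ, ValidOn O' W κ ∧ ∀ u ∈ W₀, κ u = κ₀ u

theorem mem_meeting {c u : V} : u ∈ meeting O W c ↔
    u ∈ W ∧ u ≠ c ∧ (O u c ∨ O c u ∨ ∃ s, O c s ∧ O u s) := by simp [meeting]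

/-- The new stars share no vertex with old stars of colour `α`, so within that colour no degree
changes. -/
theorem ValidOn.union {T : Finset V} {κ : V → Fin 4} {α : Fin 4} (h : ValidOn O W κ)
    (hT : ArcIrregular (fun u v => O u v ∧ u ∈ T)) (hd : ∀ u ∈ T, u ∉ W)
    (hm : ∀ u ∈ W, κ u = α → ∀ c ∈ T, u ∉ meeting O W c) :
    ValidOn O (T ∪ W) (fun u => if u ∈ T then α else κ u) := by
  intro k
  by_cases hk : k = α
  · subst hk
    refine (ArcIrregular.union hT (h k) ?_).congr ?_
    · intro u v w h1 h2
      rcases h1 with ⟨h1, h3⟩ | ⟨h1, h3⟩ <;> rcases h2 with ⟨h2, h4, h5⟩ | ⟨h2, h4, h5⟩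
      · exact hd _ h3 h4
      · exact hm w h4 h5 u h3 (mem_meeting.2 ⟨h4, fun e => hd _ h3 (e ▸ h4), Or.inl h2⟩)
      · exact hm u h4 h5 v h3 (mem_meeting.2 ⟨h4, fun e => hd _ h3 (e ▸ h4), Or.inr (Or.inl h1)⟩)
      · exact hm w h4 h5 v h3
          (mem_meeting.2 ⟨h4, fun e => hd _ h3 (e ▸ h4), Or.inr (Or.inr ⟨u, h1, h2⟩)⟩)
    · intro u v
      have := hd u
      have := hd v
      simp only [Finset.mem_union]
      split_ifs <;> tauto
  · refine (h k).congr ?_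
    intro u v
    have := hd u
    have := hd v
    simp only [Finset.mem_union]
    split_ifs <;> grind

theorem Extends.refl : Extends O W W := fun _ _ _ κ h => ⟨κ, h, fun _ _ => rfl⟩

theorem Extends.trans (h₀ : W₀ ⊆ W₁) (h1 : Extends O W₀ W₁) (h2 : Extends O W₁ W) :
    Extends O W₀ W := by
  intro O' hO hr κ hκ
  obtain ⟨κ₁, v1, e1⟩ := h1 O' hO hr κ hκ
  obtain ⟨κ₂, v2, e2⟩ := h2 O' hO (fun u hu => hr u (fun h => hu (h₀ h))) κ₁ v1
  exact ⟨κ₂, v2, fun u hu => by rw [e2 u (h₀ hu), e1 u hu]⟩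

theorem meeting_mono (hO : ∀ u v, O' u v → O u v) (h : W₀ ⊆ W) (c : V) :
    meeting O' W₀ c ⊆ meeting O W c := by
  intro u hu
  rw [mem_meeting] at hu ⊢
  obtain ⟨h1, h2, h3⟩ := hu
  refine ⟨h h1, h2, ?_⟩
  rcases h3 with h3 | h3 | ⟨s, h3, h4⟩
  · exact Or.inl (hO _ _ h3)
  · exact Or.inr (Or.inl (hO _ _ h3))
  · exact Or.inr (Or.inr ⟨s, hO _ _ h3, hO _ _ h4⟩)

theorem exists_color_avoiding (A : Finset V) (κ : V → Fin 4) (h : A.card ≤ 3) :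
    ∃ α, ∀ u ∈ A, κ u ≠ α := by
  by_contra! hne
  have : (Finset.univ : Finset (Fin 4)) ⊆ A.image κ := by
    intro α _
    obtain ⟨u, hu, e⟩ := hne α
    exact Finset.mem_image.2 ⟨u, hu, e⟩
  have h1 := Finset.card_le_card this
  have h2 := Finset.card_image_le (s := A) (f := κ)
  simp at h1
  omega

theorem extends_insert (hO : SubcubicOrientation O) {c : V} (hc : c ∉ W)
    (h2 : 2 ≤ (outN O c).card) (h3 : (meeting O W c).card ≤ 3) : Extends O W (insert c W) := by
  intro O' hO' hr κ hκ
  obtain ⟨α, hα⟩ := exists_color_avoiding _ κ h3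
  have e : outN O' c = outN O c := by
    ext v; simp only [mem_outN]; exact ⟨hO' c v, hr c hc v⟩
  refine ⟨fun u => if u ∈ ({c} : Finset V) then α else κ u, ?_, ?_⟩
  · rw [Finset.insert_eq]
    refine hκ.union ?_ (by simpa using hc) ?_
    · refine (arcIrregular_star (O := O') (c := c) (fun h => hO.asymm _ _ (hO' _ _ h) (hO' _ _ h))
        (by rw [e]; exact h2)).congr ?_
      intro u v; simp; tauto
    · intro u hu e' c' hc' hm
      rw [Finset.mem_singleton] at hc'; subst hc'
      exact hα u (meeting_mono hO' (le_refl W) _ hm) e'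
  · intro u hu
    have : u ≠ c := fun h => hc (h ▸ hu)
    simp [this]

/-- Each end may have three conflicts besides the other end. The two then either get distinct
colours or, when both are forced to the same one, form a double star, which is itself locally
irregular. -/
theorem extends_insert_pair (hO : SubcubicOrientation O) {p c : V} (hp : p ∉ W) (hc : c ∉ W)
    (hpc : O p c) (hp2 : (outN O p).card = 2) (hc2 : (outN O c).card = 2)
    (hs : ∀ s, O p s → ¬ O c s) (hp3 : (meeting O W p).card ≤ 3)
    (hc3 : (meeting O W c).card ≤ 3) : Extends O W (insert c (insert p W)) := by
  intro O' hO' hr κ hκ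
  obtain ⟨α, hα⟩ := exists_color_avoiding _ κ hp3
  have ep : outN O' p = outN O p := by
    ext v; simp only [mem_outN]; exact ⟨hO' p v, hr p hp v⟩
  have ec : outN O' c = outN O c := by
    ext v; simp only [mem_outN]; exact ⟨hO' c v, hr c hc v⟩
  have asym' : ∀ u v, O' u v → ¬ O' v u := fun u v h h' => hO.asymm _ _ (hO' _ _ h) (hO' _ _ h')
  have hne : p ≠ c := by rintro rfl; exact hO.asymm _ _ hpc hpc
  -- If no such `β` exists, the at most three conflicts of `c` already use up the three colours
  -- other than `α`, so `α` is free for `c` too.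
  by_cases hβ : ∃ β, β ≠ α ∧ ∀ u ∈ meeting O W c, κ u ≠ β
  · obtain ⟨β, hβα, hβ⟩ := hβ
    have v1 := hκ.union (T := {p}) (α := α) ?_ (by simpa using hp) ?_
    · have v2 := v1.union (T := {c}) (α := β) ?_ ?_ ?_
      · refine ⟨_, by rwa [← Finset.insert_eq, ← Finset.insert_eq] at v2, ?_⟩
        intro u hu
        have h1 : u ≠ c := fun h => hc (h ▸ hu)
        have h2 : u ≠ p := fun h => hp (h ▸ hu)
        simp [h1, h2]
      · refine (arcIrregular_star (O := O') (c := c) (fun h => asym' _ _ h h)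
          (by rw [ec]; omega)).congr ?_
        intro u v; simp; tauto
      · intro u hu; rw [Finset.mem_singleton] at hu; subst hu
        simp [hc, hne.symm]
      · intro u hu e' c' hc' hm
        rw [Finset.mem_singleton] at hc'; subst hc'
        by_cases hup : u = p
        · subst hup; simp at e'; exact hβα e'.symm
        · simp [hup] at e' hu
          refine hβ u (meeting_mono hO' (le_refl W) _ ?_) e'
          rw [mem_meeting] at hm ⊢
          exact ⟨hu, hm.2⟩
    · refine (arcIrregular_star (O := O') (c := p) (fun h => asym' _ _ h h)
        (by rw [ep]; omega)).congr ?_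
      intro u v; simp; tauto
    · intro u hu e' c' hc' hm
      rw [Finset.mem_singleton] at hc'; subst hc'
      exact hα u (meeting_mono hO' (le_refl W) _ hm) e'
  · push Not at hβ
    have hα' : ∀ u ∈ meeting O W c, κ u ≠ α := by
      intro u hu e'
      have : (Finset.univ : Finset (Fin 4)) ⊆ (meeting O W c).image κ := by
        intro γ _
        rw [Finset.mem_image]
        by_cases hγ : γ = α
        · exact ⟨u, hu, by rw [e', hγ]⟩
        · exact hβ γ hγ
      have h1 := Finset.card_le_card this
      have h2 := Finset.card_image_le (s := meeting O W c) (f := κ)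
      simp at h1
      omega
    have v1 := hκ.union (T := {c, p}) (α := α) ?_ ?_ ?_
    · refine ⟨_, by rwa [show ({c, p} : Finset V) ∪ W = insert c (insert p W) by ext; simp] at v1, ?_⟩
      intro u hu
      have h1 : u ≠ c := fun h => hc (h ▸ hu)
      have h2 : u ≠ p := fun h => hp (h ▸ hu)
      simp [h1, h2]
    · refine (arcIrregular_twoStars asym' (hr p hp c hpc) (by rw [ep, hp2]) (by rw [ec, hc2])
        (fun s h h' => hs s (hO' _ _ h) (hO' _ _ h'))).congr ?_
      intro u v; simp; tauto
    · intro u hu; simp at hu; rcases hu with rfl | rfl <;> assumption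
    · intro u hu e' c' hc' hm
      simp at hc'
      have := meeting_mono hO' (le_refl W) _ hm
      rcases hc' with rfl | rfl
      · exact hα' u this e'
      · exact hα u this e'

/-- No vertex of `W` outside `S` can be removed by `extends_insert` or `extends_insert_pair`. -/
structure IsCore (O : V → V → Prop) (S W : Finset V) : Prop where
  four_le : ∀ c ∈ W, c ∉ S → 4 ≤ (meeting O W c).card
  no_pair : ∀ p ∈ W, ∀ c ∈ W, p ∉ S → c ∉ S → O p c → (outN O p).card = 2 →
    (outN O c).card = 2 → (∀ s, O p s → ¬ O c s) →
    (meeting O ((W.erase p).erase c) p).card ≤ 3 →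
    (meeting O ((W.erase p).erase c) c).card ≤ 3 → False

/-- Tails outside `S` are peeled off singly or in pairs while possible. Composing the extensions
puts them back in reverse order. Members of `S` are never removed. -/
theorem exists_core (hO : SubcubicOrientation O) (S : Finset V) :
    ∀ (n : ℕ) (W : Finset V), W.card ≤ n → S ⊆ W → (∀ c ∈ W, c ∉ S → 2 ≤ (outN O c).card) →
    ∃ W₀, S ⊆ W₀ ∧ W₀ ⊆ W ∧ Extends O W₀ W ∧ IsCore O S W₀ := by
  intro n
  induction n with
  | zero =>
    intro W hW hS _
    have : W = ∅ := by simpa using hW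
    subst this
    exact ⟨∅, hS, le_refl _, Extends.refl, ⟨by simp, by simp⟩⟩
  | succ n ih =>
    intro W hW hS hout
    by_cases h1 : ∃ c ∈ W, c ∉ S ∧ (meeting O W c).card ≤ 3
    · obtain ⟨c, hc, hcS, h3⟩ := h1
      have hlt := Finset.card_erase_lt_of_mem hc
      obtain ⟨W₀, a1, a2, a3, a4⟩ := ih (W.erase c) (by omega)
        (fun s hs => Finset.mem_erase.2 ⟨fun e => hcS (e ▸ hs), hS hs⟩)
        (fun x hx hxS => hout x (Finset.mem_of_mem_erase hx) hxS)
      refine ⟨W₀, a1, a2.trans (Finset.erase_subset _ _), ?_, a4⟩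
      refine a3.trans a2 ?_
      have := extends_insert hO (Finset.notMem_erase c W) (hout c hc hcS)
        ((Finset.card_le_card (meeting_mono (fun _ _ h => h) (Finset.erase_subset c W) c)).trans h3)
      rwa [Finset.insert_erase hc] at this
    · by_cases h2 : ∃ p ∈ W, ∃ c ∈ W, p ∉ S ∧ c ∉ S ∧ O p c ∧ (outN O p).card = 2 ∧
          (outN O c).card = 2 ∧ (∀ s, O p s → ¬ O c s) ∧
          (meeting O ((W.erase p).erase c) p).card ≤ 3 ∧
          (meeting O ((W.erase p).erase c) c).card ≤ 3
      · obtain ⟨p, hp, c, hc, hpS, hcS, hpc, hp2, hc2, hs, hp3, hc3⟩ := h2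
        have hne : p ≠ c := by rintro rfl; exact hO.asymm _ _ hpc hpc
        have hlt := Finset.card_erase_lt_of_mem hp
        have hle := Finset.card_erase_le (s := W.erase p) (a := c)
        obtain ⟨W₀, a1, a2, a3, a4⟩ := ih ((W.erase p).erase c) (by omega)
          (fun s hs => Finset.mem_erase.2 ⟨fun e => hcS (e ▸ hs),
            Finset.mem_erase.2 ⟨fun e => hpS (e ▸ hs), hS hs⟩⟩)
          (fun x hx hxS => hout x (Finset.mem_of_mem_erase (Finset.mem_of_mem_erase hx)) hxS)
        refine ⟨W₀, a1, a2.trans ((Finset.erase_subset _ _).trans (Finset.erase_subset _ _)), ?_, a4⟩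
        refine a3.trans a2 ?_
        have := extends_insert_pair hO (p := p) (c := c) (W := (W.erase p).erase c)
          (by simp) (by simp) hpc hp2 hc2 hs hp3 hc3
        rwa [Finset.erase_right_comm, Finset.insert_erase (by simp [hp, hne]),
          Finset.insert_erase hc, Finset.erase_right_comm] at this
      · push Not at h1
        refine ⟨W, hS, le_refl _, Extends.refl, ⟨fun c hc hcS => h1 c hc hcS, ?_⟩⟩
        intro p hp c hc hpS hcS hpc hp2 hc2 hs hp3 hc3
        exact h2 ⟨p, hp, c, hc, hpS, hcS, hpc, hp2, hc2, hs, hp3, hc3⟩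

end Extension

/-- `G` has an edge-colouring with four colours, given as a function on ordered pairs, whose
colour classes are locally irregular. -/
def FourColorable {V : Type*} [Fintype V] (G : SimpleGraph V) : Prop :=
  ∃ f : V → V → Fin 4, (∀ u v, G.Adj u v → f u v = f v u) ∧
    ∀ k, ArcIrregular (fun u v => G.Adj u v ∧ f u v = k)

/-! ### Recolouring a piece of the core; structure of cores -/

section Core

open scoped Classical

variable {V : Type*} [Fintype V] {O : V → V → Prop} {G : SimpleGraph V} {S W C : Finset V}

/-- The core `W` minus the hole `H` gets colour 0 and is extended with `H` absent; `H` is coloured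
last. `Q` holds the tails outside `W` whose out-stars touch `H`, the only obstacles besides colour
0. -/
theorem FourColorable.of_hole (hO : SubcubicOrientation O)
    (hG : ∀ u v, G.Adj u v ↔ O u v ∨ O v u) (H : V → V → Prop)
    (hH : ∀ u v, H u v → O u v ∧ u ∈ W) (hHI : ArcIrregular H)
    (hB : ArcIrregular (fun u v => O u v ∧ ¬ H u v ∧ u ∈ W)) (hE : Extends O W C)
    (hC : ∀ u v, O u v → u ∈ C) (Q : Finset V) (hQ : Q.card ≤ 2)
    (hHQ : ∀ u v w, O u v → u ∉ W → (H u w ∨ H w u ∨ H v w ∨ H w v) → u ∈ Q) :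
    FourColorable G := by
  obtain ⟨κ, hκ, hκ0⟩ := hE (fun u v => O u v ∧ ¬ H u v) (fun u v h => h.1)
    (fun u hu v h => ⟨h, fun h' => hu (hH _ _ h').2⟩) (fun _ => 0) (by
      intro k
      by_cases hk : k = 0
      · exact hB.congr (by intro u v; simp [hk, and_assoc])
      · exact ArcIrregular.of_false (by intro u v; simp; grind))
  -- At most three colours are forbidden: 0 and two from `Q`. This is where `Q.card ≤ 2` comes from.
  obtain ⟨h, hh⟩ : ∃ h : Fin 4, h ∉ insert 0 (Q.image κ) := by
    by_contra! hne
    have h1 := Finset.card_le_card (show Finset.univ ⊆ insert 0 (Q.image κ) from fun x _ => hne x)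
    have h2 := Finset.card_insert_le 0 (Q.image κ)
    have h3 := Finset.card_image_le (s := Q) (f := κ)
    simp at h1
    omega
  simp only [Finset.mem_insert, Finset.mem_image, not_or, not_exists, not_and] at hh
  have hfree : ∀ u v w, O u v → κ u = h → ¬ (H u w ∨ H w u ∨ H v w ∨ H w v) := by
    intro u v w huv hu hw
    by_cases huW : u ∈ W
    · exact hh.1 (by rw [← hu]; exact hκ0 u huW)
    · exact hh.2 u (hHQ u v w huv huW hw) hu
  set g : V → V → Fin 4 := fun u v => if H u v then h else κ u with hg
  have key : ∀ k, ArcIrregular (fun u v => O u v ∧ g u v = k) := by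
    intro k
    by_cases hk : k = h
    · subst hk
      refine (ArcIrregular.union hHI (hκ k) ?_).congr ?_
      · rintro u v w h1 (⟨⟨h2, _⟩, _, h3⟩ | ⟨⟨h2, _⟩, _, h3⟩)
        · exact hfree u w v h2 h3 (by tauto)
        · exact hfree w u v h2 h3 (by tauto)
      · intro u v
        have := hC u v
        have := hC v u
        have := hH u v
        have := hH v u
        simp only [hg]
        split_ifs <;> tauto
    · refine (hκ k).congr ?_
      intro u v
      have := hC u v
      have := hC v u
      have := hH u v
      have := hH v u
      simp only [hg]
      split_ifs <;> grind
  refine ⟨fun u v => if O u v then g u v else g v u, ?_, ?_⟩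
  · intro u v huv
    have := hO.asymm u v
    have := hO.asymm v u
    rw [hG] at huv
    rcases huv with h1 | h1 <;> simp_all
  · intro k
    refine (key k).congr ?_
    intro u v
    have := hO.asymm u v
    have := hO.asymm v u
    simp only [hG]
    split_ifs <;> grind

theorem FourColorable.of_base (hO : SubcubicOrientation O)
    (hG : ∀ u v, G.Adj u v ↔ O u v ∨ O v u)
    (hB : ArcIrregular (fun u v => O u v ∧ u ∈ W)) (hE : Extends O W C)
    (hC : ∀ u v, O u v → u ∈ C) : FourColorable G :=
  FourColorable.of_hole hO hG (fun _ _ => False) (by simp)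
    (ArcIrregular.of_false (by simp)) (by simpa using hB) hE hC ∅ (by simp) (by simp)

theorem SubcubicOrientation.irrefl (hO : SubcubicOrientation O) (v : V) : ¬ O v v :=
  fun h => hO.asymm _ _ h h

theorem exists_other_of_card_two {c y : V} (h : (outN O c).card = 2) (hy : O c y) :
    ∃ s, y ≠ s ∧ ∀ z, O c z ↔ z = y ∨ z = s := by
  obtain ⟨a, b, hab, e⟩ := Finset.card_eq_two.1 h
  have e' : ∀ z, O c z ↔ z = a ∨ z = b := by intro z; rw [← mem_outN (R := O), e]; simp
  rcases (e' y).1 hy with rfl | rfl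
  · exact ⟨b, hab, e'⟩
  · exact ⟨a, hab.symm, fun z => by rw [e' z]; tauto⟩

theorem exists_of_card_two {c : V} (h : (outN O c).card = 2) :
    ∃ y s, y ≠ s ∧ ∀ z, O c z ↔ z = y ∨ z = s := by
  obtain ⟨a, b, hab, e⟩ := Finset.card_eq_two.1 h
  exact ⟨a, b, hab, by intro z; rw [← mem_outN (R := O), e]; simp⟩

/-- Besides its at most one parent and the child `y`, the tail `c` meets others only at its second
head `s`. A second child in the core would leave only three meetings. So four are reached only if
the parent is in the core, `s` has two further in-neighbours in the core, and nothing is counted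
twice. -/
theorem child_structure (hO : SubcubicOrientation O) (hcore : IsCore O S W)
    (hreg : ∀ c ∈ W, c ∉ S → (outN O c).card = 2)
    (hin : ∀ c ∈ W, c ∉ S → ∀ y ∈ W, O c y → ∀ u, O u y → u = c)
    {c y : V} (hc : c ∈ W) (hcS : c ∉ S) (hy : y ∈ W) (hcy : O c y) :
    ∃ p s, p ∈ W ∧ O p c ∧ (∀ z, O c z ↔ z = y ∨ z = s) ∧ y ≠ s ∧ s ∉ W ∧
      (inN O s).card = 3 ∧ inN O s ⊆ W ∧ ¬ O p s ∧ ¬ O y s ∧ (meeting O W c).card ≤ 4 := by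
  obtain ⟨s, hys, hout⟩ := exists_other_of_card_two (hreg c hc hcS) hcy
  have h4 := hcore.four_le c hc hcS
  have hinc : (inN O c).card ≤ 1 := by have := hO.degree_le c; have := hreg c hc hcS; omega
  set P := inN O c ∩ W with hP
  set M := (inN O s ∩ W).erase c with hM
  have hcs : O c s := (hout s).2 (Or.inr rfl)
  have hPc : P.card ≤ 1 := (Finset.card_le_card Finset.inter_subset_left).trans hinc
  have hcM : c ∈ inN O s ∩ W := by simp [hcs, hc]
  have hMc : M.card + 1 = (inN O s ∩ W).card := Finset.card_erase_add_one hcM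
  have hIW : (inN O s ∩ W).card ≤ (inN O s).card := Finset.card_le_card Finset.inter_subset_left
  have hIs : (inN O s).card ≤ 3 := by have := hO.degree_le s; omega
  have hsW : s ∉ W := by
    intro hs
    have : meeting O W c ⊆ insert s (insert y P) := by
      intro u hu
      obtain ⟨h1, h2, h3⟩ := mem_meeting.1 hu
      simp only [Finset.mem_insert, hP, Finset.mem_inter, mem_inN]
      rcases h3 with h3 | h3 | ⟨z, h3, h5⟩
      · tauto
      · rcases (hout u).1 h3 with h | h <;> tauto
      · exfalso
        rcases (hout z).1 h3 with rfl | rfl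
        · exact h2 (hin c hc hcS z hy h3 u h5)
        · exact h2 (hin c hc hcS z hs h3 u h5)
    have := Finset.card_le_card this
    have := Finset.card_insert_le s (insert y P)
    have := Finset.card_insert_le y P
    omega
  have hsub : meeting O W c ⊆ insert y (P ∪ M) := by
    intro u hu
    obtain ⟨h1, h2, h3⟩ := mem_meeting.1 hu
    simp only [Finset.mem_insert, hP, hM, Finset.mem_union, Finset.mem_erase, Finset.mem_inter,
      mem_inN]
    rcases h3 with h3 | h3 | ⟨z, h3, h5⟩
    · tauto
    · rcases (hout u).1 h3 with h | rfl
      · tauto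
      · exact absurd h1 hsW
    · rcases (hout z).1 h3 with rfl | rfl
      · exact absurd (hin c hc hcS z hy h3 u h5) h2
      · tauto
  have hcard := Finset.card_le_card hsub
  have h5 := Finset.card_insert_le y (P ∪ M)
  have h6 := Finset.card_union_le P M
  have hPne : P.Nonempty := by
    rw [← Finset.card_pos]; omega
  obtain ⟨p, hp⟩ := hPne
  have hPp : P = {p} := Finset.eq_singleton_iff_unique_mem.2
    ⟨hp, fun q hq => Finset.card_le_one.1 hPc q hq p hp⟩
  have hp' : O p c ∧ p ∈ W := by simpa [hP] using hp
  have hpc : p ≠ c := by rintro rfl; exact hO.irrefl _ hp'.1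
  have hyc : y ≠ c := by rintro rfl; exact hO.irrefl _ hcy
  refine ⟨p, s, hp'.2, hp'.1, hout, hys, hsW, by omega, ?_, ?_, ?_, by omega⟩
  · have : inN O s ∩ W = inN O s :=
      Finset.eq_of_subset_of_card_le Finset.inter_subset_left (by omega)
    rw [← this]; exact Finset.inter_subset_right
  · intro hps
    have : P ∪ M = M := by
      rw [hPp, Finset.union_eq_right, Finset.singleton_subset_iff]
      simp [hM, hps, hpc, hp'.2]
    rw [this] at h5 hcard
    omega
  · intro hys'
    have : insert y (P ∪ M) = P ∪ M := by
      apply Finset.insert_eq_of_mem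
      simp [hM, hys', hyc, hy]
    rw [this] at hcard
    omega

/-- If the parent `p` were ordinary, both `p` and `c` would have a core child and hence at most four
meetings. One of these is with each other, and they share no head, so the pair would have been
removable. -/
theorem exists_special_parent (hO : SubcubicOrientation O) (hcore : IsCore O S W)
    (hreg : ∀ c ∈ W, c ∉ S → (outN O c).card = 2)
    (hin : ∀ c ∈ W, c ∉ S → ∀ y ∈ W, O c y → ∀ u, O u y → u = c)
    {c y : V} (hc : c ∈ W) (hcS : c ∉ S) (hy : y ∈ W) (hcy : O c y) :
    ∃ p ∈ W, p ∈ S ∧ O p c := by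
  obtain ⟨p, s, hp, hpc, -, -, -, -, -, -, -, h4⟩ := child_structure hO hcore hreg hin hc hcS hy hcy
  refine ⟨p, hp, ?_, hpc⟩
  by_contra hpS
  obtain ⟨q, t, -, -, hout, -, -, -, -, -, hct, h4'⟩ :=
    child_structure hO hcore hreg hin hp hpS hc hpc
  have hne : p ≠ c := by rintro rfl; exact hO.irrefl _ hpc
  have e1 : meeting O ((W.erase p).erase c) p ⊆ (meeting O W p).erase c := by
    intro u hu
    simp only [mem_meeting, Finset.mem_erase] at hu ⊢
    tauto
  have e2 : meeting O ((W.erase p).erase c) c ⊆ (meeting O W c).erase p := by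
    intro u hu
    simp only [mem_meeting, Finset.mem_erase] at hu ⊢
    tauto
  have m1 : c ∈ meeting O W p := mem_meeting.2 ⟨hc, hne.symm, Or.inr (Or.inl hpc)⟩
  have m2 : p ∈ meeting O W c := mem_meeting.2 ⟨hp, hne, Or.inl hpc⟩
  have c1 := Finset.card_le_card e1
  have c2 := Finset.card_le_card e2
  rw [Finset.card_erase_of_mem m1] at c1
  rw [Finset.card_erase_of_mem m2] at c2
  refine hcore.no_pair p hp c hc hpS hcS hpc (hreg p hp hpS) (hreg c hc hcS) ?_ (by omega) (by omega)
  intro z hz hz'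
  rcases (hout z).1 hz with rfl | rfl
  · exact hO.irrefl _ hz'
  · exact hct hz'

/-- `s` has three in-neighbours, all of them in `W`. -/
def IsFull (O : V → V → Prop) (W : Finset V) (s : V) : Prop :=
  (inN O s).card = 3 ∧ ∀ u, O u s → u ∈ W

theorem IsFull.sink (hO : SubcubicOrientation O) {s : V} (h : IsFull O W s) (v : V) : ¬ O s v := by
  intro hv
  have h1 := hO.degree_le s
  have h2 : 0 < (outN O s).card := Finset.card_pos.2 ⟨v, by simpa using hv⟩
  have := h.1
  omega

/-- All meetings take place at the two heads, each contributing at most two. Four meetings force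
both maxima and exclude overlap. -/
theorem isolated_structure (hO : SubcubicOrientation O) {c : V} (h4 : 4 ≤ (meeting O W c).card)
    (hc : c ∈ W) (hreg : (outN O c).card = 2) (hchild : ∀ y, O c y → y ∉ W)
    (hpar : ∀ p, O p c → p ∉ W) {y : V} (hy : O c y) :
    IsFull O W y ∧ ∀ y', O c y' → y' ≠ y → ∀ u, O u y → O u y' → u = c := by
  obtain ⟨s, hys, hout⟩ := exists_other_of_card_two hreg hy
  have hcs : O c s := (hout s).2 (Or.inr rfl)
  have hb : ∀ z, O c z → ((inN O z ∩ W).erase c).card + 1 = (inN O z ∩ W).card := fun z hz =>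
    Finset.card_erase_add_one (by simp [hz, hc])
  have hb' : ∀ z, (inN O z ∩ W).card ≤ (inN O z).card := fun z =>
    Finset.card_le_card Finset.inter_subset_left
  have hb3 : ∀ z, (inN O z).card ≤ 3 := fun z => by have := hO.degree_le z; omega
  have hsub : meeting O W c ⊆ (inN O y ∩ W).erase c ∪ (inN O s ∩ W).erase c := by
    intro u hu
    obtain ⟨h1, h2, h3⟩ := mem_meeting.1 hu
    simp only [Finset.mem_union, Finset.mem_erase, Finset.mem_inter, mem_inN]
    rcases h3 with h3 | h3 | ⟨z, h3, h5⟩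
    · exact absurd h1 (hpar u h3)
    · exact absurd h1 (hchild u h3)
    · rcases (hout z).1 h3 with rfl | rfl <;> tauto
  have hcard := Finset.card_le_card hsub
  have h6 := Finset.card_union_le ((inN O y ∩ W).erase c) ((inN O s ∩ W).erase c)
  have hy1 := hb y hy
  have hy2 := hb' y
  have hy3 := hb3 y
  have hs1 := hb s hcs
  have hs2 := hb' s
  have hs3 := hb3 s
  refine ⟨⟨by omega, ?_⟩, ?_⟩
  · have : inN O y ∩ W = inN O y :=
      Finset.eq_of_subset_of_card_le Finset.inter_subset_left (by omega)
    intro u hu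
    exact (Finset.mem_inter.1 (show u ∈ inN O y ∩ W by rw [this]; exact mem_inN.2 hu)).2
  · intro y' hy' hne u hu hu'
    obtain rfl : y' = s := by rcases (hout y').1 hy' with h | h <;> tauto
    by_contra huc
    have := Finset.card_union_add_card_inter ((inN O y ∩ W).erase c) ((inN O y' ∩ W).erase c)
    have hdis : 0 < ((inN O y ∩ W).erase c ∩ (inN O y' ∩ W).erase c).card := by
      refine Finset.card_pos.2 ⟨u, ?_⟩
      have : inN O y ∩ W = inN O y :=
        Finset.eq_of_subset_of_card_le Finset.inter_subset_left (by omega)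
      have : u ∈ inN O y ∩ W := by rw [this]; exact mem_inN.2 hu
      simp only [Finset.mem_inter, Finset.mem_erase, mem_inN] at this ⊢
      tauto
    omega

end Core

/-! ### Reversing an arc -/

section Flip

open scoped Classical

variable {V : Type*} [Fintype V] {O : V → V → Prop} {G : SimpleGraph V} {a b : V}

/-- Reverse the arc from `a` to `b`. -/
def flipArc (O : V → V → Prop) (a b : V) : V → V → Prop :=
  fun u v => (O u v ∧ ¬ (u = a ∧ v = b)) ∨ (u = b ∧ v = a)

theorem outN_flipArc_tail (hab : a ≠ b) : outN (flipArc O a b) a = (outN O a).erase b := by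
  ext w; simp [flipArc, hab]; tauto

theorem outN_flipArc_head (hab : a ≠ b) : outN (flipArc O a b) b = insert a (outN O b) := by
  ext w; simp [flipArc, hab.symm]; tauto

theorem outN_flipArc_of_ne {v : V} (ha : v ≠ a) (hb : v ≠ b) :
    outN (flipArc O a b) v = outN O v := by
  ext w; simp [flipArc, ha, hb]

theorem inN_flipArc_head (hab : a ≠ b) : inN (flipArc O a b) b = (inN O b).erase a := by
  ext w; simp [flipArc, hab.symm]; tauto

theorem inN_flipArc_tail (hab : a ≠ b) : inN (flipArc O a b) a = insert b (inN O a) := by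
  ext w; simp [flipArc, hab]; tauto

theorem inN_flipArc_of_ne {v : V} (ha : v ≠ a) (hb : v ≠ b) :
    inN (flipArc O a b) v = inN O v := by
  ext w; simp [flipArc, ha, hb]

theorem SubcubicOrientation.flipArc (hO : SubcubicOrientation O) (hab : O a b) :
    SubcubicOrientation (flipArc O a b) := by
  have hne : a ≠ b := by rintro rfl; exact hO.asymm _ _ hab hab
  have hba := hO.asymm _ _ hab
  refine ⟨?_, ?_⟩
  · intro u v h h'
    have := hO.asymm u v
    unfold _root_.flipArc at h h'
    grind
  · intro v
    have hd := hO.degree_le v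
    by_cases hva : v = a
    · subst hva
      rw [outN_flipArc_tail hne, inN_flipArc_tail hne, Finset.card_insert_of_notMem (by simpa),
        Finset.card_erase_of_mem (by simpa)]
      have : 0 < (outN O v).card := Finset.card_pos.2 ⟨b, by simpa⟩
      omega
    · by_cases hvb : v = b
      · subst hvb
        rw [outN_flipArc_head hne, inN_flipArc_head hne, Finset.card_insert_of_notMem (by simpa),
          Finset.card_erase_of_mem (by simpa)]
        have : 0 < (inN O v).card := Finset.card_pos.2 ⟨a, by simpa⟩
        omega
      · rwa [outN_flipArc_of_ne hva hvb, inN_flipArc_of_ne hva hvb]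

omit [Fintype V] in
theorem flipArc_symm_closure (hab : O a b) (u v : V) :
    (flipArc O a b u v ∨ flipArc O a b v u) ↔ (O u v ∨ O v u) := by
  unfold flipArc; grind

end Flip

/-! ### Orientations with even out-degrees, and spiders ending in sinks -/

section Base

open scoped Classical

variable {V : Type*} [Fintype V] {O : V → V → Prop} {G : SimpleGraph V} {S W C : Finset V}

theorem IsCore.mono {S' : Finset V} (h : IsCore O S W) (hS : S ⊆ S') : IsCore O S' W :=
  ⟨fun c hc hcS => h.four_le c hc (fun h' => hcS (hS h')),
    fun p hp c hc hpS hcS => h.no_pair p hp c hc (fun h' => hpS (hS h')) (fun h' => hcS (hS h'))⟩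

/-- `c ∈ W` has out-degree two, no neighbours in `W`, and its two out-neighbours are full and
have no other common in-neighbour. -/
structure IsIsolated (O : V → V → Prop) (W : Finset V) (c : V) : Prop where
  mem : c ∈ W
  card_out : (outN O c).card = 2
  full : ∀ y, O c y → IsFull O W y
  no_parent : ∀ p ∈ W, ¬ O p c
  unique : ∀ y y' u, O c y → O c y' → y ≠ y' → O u y → O u y' → u = c

theorem IsIsolated.of_core (hO : SubcubicOrientation O) (hcore : IsCore O S W)
    (hreg : ∀ c ∈ W, c ∉ S → (outN O c).card = 2) {c : V} (hc : c ∈ W) (hcS : c ∉ S)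
    (hchild : ∀ y, O c y → y ∉ W) (hpar : ∀ p, O p c → p ∉ W) : IsIsolated O W c := by
  have h4 := hcore.four_le c hc hcS
  refine ⟨hc, hreg c hc hcS,
    fun y hy => (isolated_structure hO h4 hc (hreg c hc hcS) hchild hpar hy).1,
    fun p hp h => hpar p h hp, ?_⟩
  intro y y' u hy hy' hne hu hu'
  exact (isolated_structure hO h4 hc (hreg c hc hcS) hchild hpar hy).2 y' hy' hne.symm u hu hu'

/-- An arc between ordinary core tails would force an arc from a special tail to an ordinary one, by
`exists_special_parent`, and none exists here. -/
theorem IsIsolated.of_core_of_no_parent (hO : SubcubicOrientation O) (hcore : IsCore O S W)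
    (hreg : ∀ c ∈ W, c ∉ S → (outN O c).card = 2)
    (hin : ∀ c ∈ W, c ∉ S → ∀ y ∈ W, O c y → ∀ u, O u y → u = c)
    (hpar : ∀ p ∈ W, p ∈ S → ∀ c ∈ W, c ∉ S → ¬ O p c) {c : V} (hc : c ∈ W) (hcS : c ∉ S) :
    IsIsolated O W c := by
  have hchild : ∀ c ∈ W, c ∉ S → ∀ y, O c y → y ∉ W := by
    intro c hc hcS y hy hyW
    obtain ⟨p, hp, hpS, h⟩ := exists_special_parent hO hcore hreg hin hc hcS hyW hy
    exact hpar p hp hpS c hc hcS h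
  refine IsIsolated.of_core hO hcore hreg hc hcS (hchild c hc hcS) ?_
  intro p hpc hp
  by_cases hpS : p ∈ S
  · exact hpar p hp hpS c hc hcS hpc
  · exact hchild p hp hpS c hpc hc

theorem SubcubicOrientation.parent_unique (hO : SubcubicOrientation O) {y c u : V}
    (h : 2 ≤ (outN O y).card) (hc : O c y) (hu : O u y) : u = c := by
  have := hO.degree_le y
  exact Finset.card_le_one.1 (show (inN O y).card ≤ 1 by omega) u (by simpa) c (by simpa)

/-- The in-neighbours of a full vertex, given two of them. -/
theorem IsFull.exists_third {s u v : V} (h : IsFull O W s) (hu : O u s) (hv : O v s) (huv : u ≠ v) :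
    ∃ e, e ≠ u ∧ e ≠ v ∧ e ∈ W ∧ ∀ w, O w s ↔ w = u ∨ w = v ∨ w = e := by
  have h1 : ((inN O s).erase u).erase v = (inN O s) \ {u, v} := by ext; simp; tauto
  have hc : (((inN O s).erase u).erase v).card = 1 := by
    rw [Finset.card_erase_of_mem (by simp [hv, huv.symm]), Finset.card_erase_of_mem (by simpa), h.1]
  obtain ⟨e, he⟩ := Finset.card_eq_one.1 hc
  have he' : ∀ w, (w ≠ v ∧ w ≠ u ∧ O w s) ↔ w = e := by
    intro w
    have := Finset.ext_iff.1 he w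
    simpa using this
  have hee := (he' e).2 rfl
  refine ⟨e, hee.2.1, hee.1, h.2 _ hee.2.2, ?_⟩
  intro w
  have := he' w
  constructor
  · intro hw; by_cases w = u <;> by_cases w = v <;> tauto
  · rintro (rfl | rfl | rfl)
    · exact hu
    · exact hv
    · exact hee.2.2

theorem card_arcNeighbors_full (hO : SubcubicOrientation O) {B : V → V → Prop} {s : V}
    (h : IsFull O W s) (hB : ∀ u v, B u v → O u v) (hB' : ∀ u, O u s → B u s) :
    (arcNeighbors B s).card = 3 := by
  rw [← h.1]; congr 1; ext w
  have := h.sink hO w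
  have := hB s w
  have := hB w s
  have := hB' w
  simp; tauto

theorem IsIsolated.card_arcNeighbors {B : V → V → Prop} {c : V}
    (h : IsIsolated O W c) (hB : ∀ u v, B u v → O u v ∧ u ∈ W) (hB' : ∀ u, O c u → B c u) :
    (arcNeighbors B c).card = 2 := by
  rw [← h.card_out]; congr 1; ext w
  have := h.no_parent w
  have := hB c w
  have := hB w c
  have := hB' w
  simp; tauto

theorem IsIsolated.card_arcNeighbors_of_removed {B : V → V → Prop} {c a : V} (h : IsIsolated O W c) (hB : ∀ u v, B u v → O u v ∧ u ∈ W)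
    (ha : O c a) (hB' : ∀ u, B c u ↔ O c u ∧ u ≠ a) :
    (arcNeighbors B c).card = 1 := by
  have : arcNeighbors B c = (outN O c).erase a := by
    ext w
    have := h.no_parent w
    have := hB w c
    have := hB' w
    simp; tauto
  rw [this, Finset.card_erase_of_mem (by simpa), h.card_out]

/-- In the core every tail has degree 2 and every head degree 3, so one colour suffices. -/
theorem FourColorable.of_isolated (hO : SubcubicOrientation O)
    (hG : ∀ u v, G.Adj u v ↔ O u v ∨ O v u) (hI : ∀ c ∈ W, IsIsolated O W c)
    (hE : Extends O W C) (hC : ∀ u v, O u v → u ∈ C) : FourColorable G := by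
  refine FourColorable.of_base hO hG ?_ hE hC
  rintro u v ⟨huv, hu⟩
  rw [(hI u hu).card_arcNeighbors (fun _ _ h => h) (fun w hw => ⟨hw, hu⟩),
    card_arcNeighbors_full hO ((hI u hu).full v huv) (fun _ _ h => h.1)
      (fun w hw => ⟨hw, ((hI u hu).full v huv).2 w hw⟩)]
  simp

theorem FourColorable.of_core_even (hO : SubcubicOrientation O)
    (hG : ∀ u v, G.Adj u v ↔ O u v ∨ O v u) (hcore : IsCore O ∅ W)
    (hreg : ∀ c ∈ W, (outN O c).card = 2)
    (hE : Extends O W C) (hC : ∀ u v, O u v → u ∈ C) : FourColorable G := by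
  refine FourColorable.of_isolated hO hG (W := W) ?_ hE hC
  intro c hc
  exact IsIsolated.of_core_of_no_parent hO hcore (fun c hc _ => hreg c hc)
    (fun c hc _ y hy hcy u hu => hO.parent_unique (by rw [hreg y hy]) hcy hu)
    (by simp) hc (by simp)

/-- Every out-degree is zero or two. -/
theorem FourColorable.of_even (hO : SubcubicOrientation O)
    (hG : ∀ u v, G.Adj u v ↔ O u v ∨ O v u)
    (h : ∀ v, (outN O v).card = 0 ∨ (outN O v).card = 2) : FourColorable G := by
  have h2 : ∀ v, (outN O v).Nonempty → (outN O v).card = 2 := by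
    intro v hv
    have := Finset.card_pos.2 hv
    have := h v
    omega
  obtain ⟨W, -, hWC, hE, hcore⟩ := exists_core hO ∅ _ {v | (outN O v).Nonempty} le_rfl (by simp)
    (by intro c hc _; rw [h2 c (by simpa using hc)])
  refine FourColorable.of_core_even hO hG hcore ?_ hE (fun u v huv => by simpa using ⟨v, by simpa⟩)
  intro c hc
  exact h2 c (by simpa using hWC hc)

/-- `z` has out-degree one, and together with two in-neighbours of out-degree two it spans
a tree with five edges. -/
def IsSpiderCenter (O : V → V → Prop) (z a v₁ w₁ v₂ w₂ : V) : Prop :=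
  (∀ u, O z u ↔ u = a) ∧ (∀ u, O v₁ u ↔ u = z ∨ u = w₁) ∧ (∀ u, O v₂ u ↔ u = z ∨ u = w₂) ∧
    v₁ ≠ v₂ ∧ w₁ ≠ w₂ ∧ a ≠ w₁ ∧ a ≠ w₂ ∧ z ≠ w₁ ∧ z ≠ w₂

/-- The spider stays in the core as the special set, with degrees 3 at `z` and 2 at `v₁`, `v₂`. The
ends `w₁`, `w₂` have degree 1, or 3 if full, which is harmless next to 2. Only `a` can clash, having
degree 3 next to `z` when full. -/
theorem FourColorable.of_spiderCenter_of_sinks (hO : SubcubicOrientation O)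
    (hG : ∀ u v, G.Adj u v ↔ O u v ∨ O v u) {z a v₁ w₁ v₂ w₂ : V}
    (hz : IsSpiderCenter O z a v₁ w₁ v₂ w₂)
    (h : ∀ v, v ≠ z → (outN O v).card = 0 ∨ (outN O v).card = 2)
    (ha : ∀ u, ¬ O a u) (hw₁ : ∀ u, ¬ O w₁ u) (hw₂ : ∀ u, ¬ O w₂ u) : FourColorable G := by
  obtain ⟨hza, hv₁, hv₂, hv, hw, haw₁, haw₂, hzw₁, hzw₂⟩ := hz
  have h2 : ∀ v, v ≠ z → (outN O v).Nonempty → (outN O v).card = 2 := by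
    intro v hv hv'
    have := Finset.card_pos.2 hv'
    have := h v hv
    omega
  have z1 : O v₁ z := (hv₁ z).2 (Or.inl rfl)
  have z2 : O v₂ z := (hv₂ z).2 (Or.inl rfl)
  have za : O z a := (hza a).2 rfl
  have inz : ∀ u, O u z ↔ u = v₁ ∨ u = v₂ := by
    have hd := hO.degree_le z
    have h1 : 0 < (outN O z).card := Finset.card_pos.2 ⟨a, by simpa⟩
    have : {v₁, v₂} = inN O z := by
      refine Finset.eq_of_subset_of_card_le ?_ (by rw [Finset.card_pair hv]; omega)
      intro u hu; simp at hu; rcases hu with rfl | rfl <;> simpa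
    intro u
    rw [← mem_inN (R := O), ← this]; simp
  set S : Finset V := {z, v₁, v₂} with hS
  have memS : ∀ u, u ∈ S ↔ u = z ∨ u = v₁ ∨ u = v₂ := by simp [hS]
  obtain ⟨W, hSW, hWC, hE, hcore⟩ := exists_core hO S _ {v | (outN O v).Nonempty} le_rfl
    (by
      intro u hu
      rcases (memS u).1 hu with rfl | rfl | rfl
      · simpa using ⟨a, by simpa⟩
      · simpa using ⟨z, by simpa⟩
      · simpa using ⟨z, by simpa⟩)
    (by
      intro c hc hcS
      rw [h2 c (fun e => hcS (by simp [memS, e])) (by simpa using hc)])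
  have hreg : ∀ c ∈ W, c ∉ S → (outN O c).card = 2 := by
    intro c hc hcS
    exact h2 c (fun e => hcS (by simp [memS, e])) (by simpa using hWC hc)
  have hne : ∀ c ∈ W, ∃ y, O c y := by
    intro c hc
    have := hWC hc
    simpa [Finset.Nonempty] using this
  have hin : ∀ c ∈ W, c ∉ S → ∀ y ∈ W, O c y → ∀ u, O u y → u = c := by
    intro c hc hcS y hy hcy u hu
    by_cases hyz : y = z
    · subst hyz
      exact absurd ((inz c).1 hcy) (fun h' => hcS ((memS c).2 (Or.inr h')))
    · refine hO.parent_unique ?_ hcy hu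
      rw [h2 y hyz (by simpa using hWC hy)]
  have hI : ∀ c ∈ W, c ∉ S → IsIsolated O W c := by
    intro c hc hcS
    refine IsIsolated.of_core_of_no_parent hO hcore hreg hin ?_ hc hcS
    intro p hp hpS c hc hcS hpc
    obtain ⟨y, hy⟩ := hne c hc
    rcases (memS p).1 hpS with rfl | rfl | rfl
    · rw [(hza c).1 hpc] at hy; exact ha _ hy
    · rcases (hv₁ c).1 hpc with rfl | rfl
      · exact hcS (by simp [memS])
      · exact hw₁ _ hy
    · rcases (hv₂ c).1 hpc with rfl | rfl
      · exact hcS (by simp [memS])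
      · exact hw₂ _ hy
  have hzW : z ∈ W := hSW (by simp [memS])
  have h1W : v₁ ∈ W := hSW (by simp [memS])
  have h2W : v₂ ∈ W := hSW (by simp [memS])
  have hz1 : z ≠ v₁ := by rintro rfl; exact hO.irrefl _ z1
  have hz2 : z ≠ v₂ := by rintro rfl; exact hO.irrefl _ z2
  have hza' : z ≠ a := by rintro rfl; exact hO.irrefl _ za
  have hnS : ∀ u, O u a → u ≠ z → u ∉ S := by
    intro u hu huz huS
    rcases (memS u).1 huS with rfl | rfl | rfl
    · exact huz rfl
    · rcases (hv₁ a).1 hu with h | h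
      · exact hza' h.symm
      · exact haw₁ h
    · rcases (hv₂ a).1 hu with h | h
      · exact hza' h.symm
      · exact haw₂ h
  -- Cutting the other core arcs into `a` lowers its degree to 1. Their tails drop to degree 1,
  -- still different from the degree 3 of their other head.
  set H : V → V → Prop := fun u v => O u v ∧ u ∈ W ∧ v = a ∧ u ≠ z with hH
  set B : V → V → Prop := fun u v => O u v ∧ ¬ H u v ∧ u ∈ W with hB
  have hBO : ∀ u v, B u v → O u v ∧ u ∈ W := fun u v h => ⟨h.1, h.2.2⟩
  have hB' : ∀ u v, O u v → u ∈ W → (v = a → u = z) → B u v := by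
    intro u v h1 h2 h3; exact ⟨h1, fun h => h.2.2.2 (h3 h.2.2.1), h2⟩
  have dz : (arcNeighbors B z).card = 3 := by
    rw [Finset.card_eq_three]
    refine ⟨a, v₁, v₂, ?_, ?_, hv, ?_⟩
    · rintro rfl; exact ha _ z1
    · rintro rfl; exact ha _ z2
    · ext w
      simp only [mem_arcNeighbors, Finset.mem_insert, Finset.mem_singleton]
      constructor
      · rintro (h | h)
        · exact Or.inl ((hza w).1 h.1)
        · exact Or.inr ((inz w).1 h.1)
      · rintro (rfl | rfl | rfl)
        · exact Or.inl (hB' _ _ za hzW (fun _ => rfl))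
        · exact Or.inr (hB' _ _ z1 h1W (fun h => absurd h hza'))
        · exact Or.inr (hB' _ _ z2 h2W (fun h => absurd h hza'))
  have da : (arcNeighbors B a).card = 1 := by
    rw [Finset.card_eq_one]
    refine ⟨z, ?_⟩
    ext w
    simp only [mem_arcNeighbors, Finset.mem_singleton]
    constructor
    · rintro (h | h)
      · exact absurd h.1 (ha w)
      · by_contra hwz
        exact h.2.1 ⟨h.1, h.2.2, rfl, hwz⟩
    · rintro rfl; exact Or.inr (hB' _ _ za hzW (fun _ => rfl))
  have dv : ∀ v w, (v = v₁ ∧ w = w₁ ∨ v = v₂ ∧ w = w₂) → (arcNeighbors B v).card = 2 := by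
    intro v w hvw
    have hvz : ∀ u, O v u ↔ u = z ∨ u = w := by
      rcases hvw with ⟨rfl, rfl⟩ | ⟨rfl, rfl⟩ <;> assumption
    have hvW : v ∈ W := by rcases hvw with ⟨rfl, rfl⟩ | ⟨rfl, rfl⟩ <;> assumption
    have hwz : z ≠ w := by rcases hvw with ⟨rfl, rfl⟩ | ⟨rfl, rfl⟩ <;> assumption
    have hwa : a ≠ w := by rcases hvw with ⟨rfl, rfl⟩ | ⟨rfl, rfl⟩ <;> assumption
    rw [Finset.card_eq_two]
    refine ⟨z, w, hwz, ?_⟩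
    ext u
    simp only [mem_arcNeighbors, Finset.mem_insert, Finset.mem_singleton]
    constructor
    · rintro (h | h)
      · exact (hvz u).1 h.1
      · exfalso
        have vz : O v z := (hvz z).2 (Or.inl rfl)
        by_cases huS : u ∈ S
        · rcases (memS u).1 huS with rfl | rfl | rfl
          · exact hO.asymm _ _ vz h.1
          · rcases (hv₁ v).1 h.1 with rfl | rfl
            · exact hO.irrefl _ vz
            · exact hw₁ _ vz
          · rcases (hv₂ v).1 h.1 with rfl | rfl
            · exact hO.irrefl _ vz
            · exact hw₂ _ vz
        · exact ((hI u h.2.2 huS).full v h.1).sink hO _ vz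
    · intro hu
      refine Or.inl (hB' _ _ ((hvz u).2 hu) hvW ?_)
      rintro rfl
      rcases hu with h | h
      · exact absurd h.symm hza'
      · exact absurd h hwa
  have dw : ∀ v w, (v = v₁ ∧ w = w₁ ∨ v = v₂ ∧ w = w₂) → (arcNeighbors B w).card ≠ 2 := by
    intro v w hvw
    have hvw' : O v w := by
      rcases hvw with ⟨rfl, rfl⟩ | ⟨rfl, rfl⟩
      · exact (hv₁ _).2 (Or.inr rfl)
      · exact (hv₂ _).2 (Or.inr rfl)
    have hvW : v ∈ W := by rcases hvw with ⟨rfl, rfl⟩ | ⟨rfl, rfl⟩ <;> assumption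
    have hwa : a ≠ w := by rcases hvw with ⟨rfl, rfl⟩ | ⟨rfl, rfl⟩ <;> assumption
    by_cases hf : IsFull O W w
    · rw [card_arcNeighbors_full hO hf (fun u v h => h.1)
        (fun u hu => hB' _ _ hu (hf.2 u hu) (fun h => absurd h.symm hwa))]
      simp
    · have : arcNeighbors B w = {v} := by
        ext u
        simp only [mem_arcNeighbors, Finset.mem_singleton]
        constructor
        · rintro (h | h)
          · exfalso
            rcases hvw with ⟨rfl, rfl⟩ | ⟨rfl, rfl⟩
            · exact hw₁ _ h.1
            · exact hw₂ _ h.1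
          · have huS : u ∈ S := by
              by_contra huS
              exact hf ((hI u h.2.2 huS).full w h.1)
            rcases (memS u).1 huS with rfl | rfl | rfl
            · exact absurd ((hza w).1 h.1).symm hwa
            · rcases hvw with ⟨rfl, rfl⟩ | ⟨rfl, rfl⟩
              · rfl
              · rcases (hv₁ w).1 h.1 with h | h
                · exact absurd h.symm hzw₂
                · exact absurd h.symm hw
            · rcases hvw with ⟨rfl, rfl⟩ | ⟨rfl, rfl⟩
              · rcases (hv₂ w).1 h.1 with h | h
                · exact absurd h.symm hzw₁
                · exact absurd h hw
              · rfl
        · rintro rfl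
          exact Or.inr (hB' _ _ hvw' hvW (fun h => absurd h.symm hwa))
      rw [this]; simp
  have base : ArcIrregular B := by
    intro u v huv
    by_cases huS : u ∈ S
    · rcases (memS u).1 huS with rfl | rfl | rfl
      · rw [(hza v).1 huv.1, dz, da]; simp
      · rw [dv u w₁ (Or.inl ⟨rfl, rfl⟩)]
        rcases (hv₁ v).1 huv.1 with rfl | rfl
        · rw [dz]; simp
        · exact (dw u _ (Or.inl ⟨rfl, rfl⟩)).symm
      · rw [dv u w₂ (Or.inr ⟨rfl, rfl⟩)]
        rcases (hv₂ v).1 huv.1 with rfl | rfl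
        · rw [dz]; simp
        · exact (dw u _ (Or.inr ⟨rfl, rfl⟩)).symm
    · have hu := hI u huv.2.2 huS
      have hva : v ≠ a := by
        rintro rfl
        refine huv.2.1 ⟨huv.1, huv.2.2, rfl, ?_⟩
        rintro rfl; exact huS (by simp [memS])
      have hf := hu.full v huv.1
      rw [card_arcNeighbors_full hO hf (fun u v h => h.1)
        (fun u hu => hB' _ _ hu (hf.2 u hu) (fun h => absurd h hva))]
      by_cases hua : O u a
      · rw [hu.card_arcNeighbors_of_removed hBO hua]
        · simp
        · intro w
          constructor
          · intro h
            refine ⟨h.1, ?_⟩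
            rintro rfl
            exact h.2.1 ⟨h.1, huv.2.2, rfl, fun e => huS (by simp [memS, e])⟩
          · intro h
            exact hB' _ _ h.1 huv.2.2 (fun h' => absurd h' h.2)
      · rw [hu.card_arcNeighbors hBO]
        · simp
        · intro w hw
          exact hB' _ _ hw huv.2.2 (by rintro rfl; exact absurd hw hua)
  -- One such `d` is isolated in the core, so it makes `a` full and `H` is a cherry centred at `a`.
  -- Its ends `d`, `e` have at most one in-neighbour each. Without such a `d`, `H` is empty.
  by_cases ht : ∃ d ∈ W, O d a ∧ d ≠ z
  · obtain ⟨d, hdW, hda, hdz⟩ := ht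
    have hd := hI d hdW (hnS d hda hdz)
    have hf := hd.full a hda
    obtain ⟨e, hez, hed, heW, hina⟩ := hf.exists_third za hda hdz.symm
    have hea : O e a := (hina e).2 (by simp)
    have he := hI e heW (hnS e hea hez)
    have had : a ≠ d := by rintro rfl; exact hO.irrefl _ hda
    have hae : a ≠ e := by rintro rfl; exact hO.irrefl _ hea
    refine FourColorable.of_hole hO hG H (fun u v h => ⟨h.1, h.2.1⟩) ?_ base hE
      (fun u v huv => by simpa using ⟨v, by simpa⟩) (inN O d ∪ inN O e) ?_ ?_
    · refine (arcIrregular_cherry had hae hed.symm).congr ?_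
      intro u v
      have h1 := hina u
      have h2 := hina v
      simp only [hH]
      grind
    · have h1 := hO.degree_le d
      have h2 := hO.degree_le e
      have h3 := hd.card_out
      have h4 := he.card_out
      have := Finset.card_union_le (inN O d) (inN O e)
      omega
    · intro u v w huv huW hm
      simp only [Finset.mem_union, mem_inN]
      rcases hm with hm | hm | hm | hm
      · exact absurd hm.2.1 huW
      · rw [hm.2.2.1] at huv; exact absurd huv (ha _)
      · rcases (hina v).1 (hm.2.2.1 ▸ hm.1) with rfl | rfl | rfl
        · exact absurd rfl hm.2.2.2
        · exact Or.inl huv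
        · exact Or.inr huv
      · rw [hm.2.2.1] at huv; exact absurd (hf.2 u huv) huW
  · push Not at ht
    refine FourColorable.of_base hO hG ?_ hE (fun u v huv => by simpa using ⟨v, by simpa⟩)
    refine base.congr ?_
    intro u v
    have h1 := ht u
    have h2 := ht v
    simp only [hB, hH]
    grind

end Base

/-! ### One vertex of out-degree three: structure of its core -/

section Claw

open scoped Classical

variable {V : Type*} [Fintype V] {O : V → V → Prop} {G : SimpleGraph V} {W C : Finset V} {x : V}

/-- All out-degrees are zero or two, except that of `x`, which is three. -/
structure IsClawOrientation (O : V → V → Prop) (x : V) : Prop extends SubcubicOrientation O where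
  card_out : (outN O x).card = 3
  card_out_of_ne : ∀ v, v ≠ x → (outN O v).card = 0 ∨ (outN O v).card = 2

/-- The number of out-neighbours of `x` that are sinks. -/
noncomputable def sinkCount (O : V → V → Prop) (x : V) : ℕ :=
  {s ∈ outN O x | outN O s = ∅}.card

theorem outN_eq_empty {v : V} : outN O v = ∅ ↔ ∀ u, ¬ O v u := by
  rw [Finset.eq_empty_iff_forall_notMem]; simp

theorem IsClawOrientation.no_in (hO : IsClawOrientation O x) (u : V) : ¬ O u x := by
  intro h
  have h1 := hO.degree_le x
  have h2 := hO.card_out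
  have h3 : 0 < (inN O x).card := Finset.card_pos.2 ⟨u, by simpa⟩
  omega

/-- Reversal takes the out-degree of `x` from 3 to 2 and that of `y` from 2 to 3: the centre of the
claw moves to `y`. -/
theorem IsClawOrientation.flipArc (hO : IsClawOrientation O x) {y : V} (hxy : O x y)
    (hy : (outN O y).Nonempty) : IsClawOrientation (flipArc O x y) y := by
  have hne : x ≠ y := by rintro rfl; exact hO.irrefl _ hxy
  refine ⟨hO.toSubcubicOrientation.flipArc hxy, ?_, ?_⟩
  · rw [outN_flipArc_head hne, Finset.card_insert_of_notMem (by simpa using hO.asymm _ _ hxy)]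
    have := Finset.card_pos.2 hy
    have := hO.card_out_of_ne y hne.symm
    omega
  · intro v hv
    by_cases hvx : v = x
    · subst hvx
      rw [outN_flipArc_tail hne, Finset.card_erase_of_mem (by simpa), hO.card_out]
      simp
    · rw [outN_flipArc_of_ne hvx hv]
      exact hO.card_out_of_ne v hvx

/-- A core of a claw orientation that contains the centre of the claw. -/
structure IsClawCore (O : V → V → Prop) (x : V) (W : Finset V) : Prop
    extends IsClawOrientation O x where
  core : IsCore O ∅ W
  mem : x ∈ W
  nonempty : ∀ c ∈ W, (outN O c).Nonempty

namespace IsClawCore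

variable (h : IsClawCore O x W)
include h

theorem card_two {c : V} (hc : c ∈ W) (hcx : c ≠ x) : (outN O c).card = 2 := by
  have := Finset.card_pos.2 (h.nonempty c hc)
  have := h.card_out_of_ne c hcx
  omega

theorem not_mem_of_sink {s : V} (hs : ∀ u, ¬ O s u) : s ∉ W := by
  intro hsW
  have := h.nonempty s hsW
  rw [outN_eq_empty.2 hs] at this
  simp at this

theorem unique_parent {c y u : V} (hy : y ∈ W) (hcy : O c y) (hu : O u y) : u = c := by
  refine h.parent_unique ?_ hcy hu
  rw [h.card_two hy]
  rintro rfl; exact h.no_in _ hcy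

theorem core' : IsCore O {x} W := h.core.mono (by simp)

/-- With `{x}` as the special set, the special parent can only be `x`. This bounds directed paths in
the core to two arcs. -/
theorem structure_of_child {c y : V} (hc : c ∈ W) (hcx : c ≠ x) (hy : y ∈ W) (hcy : O c y) :
    O x c ∧ ∃ s, (∀ z, O c z ↔ z = y ∨ z = s) ∧ y ≠ s ∧ s ∉ W ∧ IsFull O W s ∧ ¬ O y s := by
  have h1 : ∀ c ∈ W, c ∉ ({x} : Finset V) → (outN O c).card = 2 := fun c hc hcx =>
    h.card_two hc (by simpa using hcx)
  have h2 : ∀ c ∈ W, c ∉ ({x} : Finset V) → ∀ y ∈ W, O c y → ∀ u, O u y → u = c :=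
    fun c hc _ y hy hcy u hu => h.unique_parent hy hcy hu
  obtain ⟨p, hp, hpx, hpc⟩ := exists_special_parent h.toSubcubicOrientation h.core' h1 h2 hc
    (by simpa using hcx) hy hcy
  obtain ⟨q, s, -, -, ho, hys, hs, hs3, hsW, -, hn, -⟩ := child_structure h.toSubcubicOrientation
    h.core' h1 h2 hc (by simpa using hcx) hy hcy
  refine ⟨by rwa [Finset.mem_singleton.1 hpx] at hpc, s, ho, hys, hs, ⟨hs3, ?_⟩, hn⟩
  intro u hu
  exact hsW (by simpa)

theorem isolated {c : V} (hc : c ∈ W) (hcx : c ≠ x) (hchild : ∀ y, O c y → y ∉ W)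
    (hpar : ∀ p, O p c → p ∉ W) : IsIsolated O W c :=
  IsIsolated.of_core h.toSubcubicOrientation h.core'
    (fun c hc hcx => h.card_two hc (by simpa using hcx)) hc (by simpa using hcx) hchild hpar

/-- All core tails other than `x` are isolated, and only `x`, of degree 3, can clash with full
heads. Some tail `d` meets `x` at a full head `a`; cutting out `x → a` and `d → a` leaves degrees 2
at `x`, and 1 at `a` and `d`. -/
theorem fourColorable_of_no_child (hG : ∀ u v, G.Adj u v ↔ O u v ∨ O v u)
    (hE : Extends O W C) (hC : ∀ u v, O u v → u ∈ C) (hx : ∀ y, O x y → y ∉ W) :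
    FourColorable G := by
  have hI : ∀ c ∈ W, c ≠ x → IsIsolated O W c := by
    intro c hc hcx
    refine h.isolated hc hcx ?_ ?_
    · intro y hy hyW
      exact hx c (h.structure_of_child hc hcx hyW hy).1 hc
    · intro p hpc hp
      have hpx : p ≠ x := by rintro rfl; exact hx c hpc hc
      exact hx p (h.structure_of_child hp hpx hc hpc).1 hp
  have h4 := h.core.four_le x h.mem (by simp)
  obtain ⟨d, hd⟩ := Finset.card_pos.1 (show 0 < (meeting O W x).card by omega)
  obtain ⟨hdW, hdx, hd'⟩ := mem_meeting.1 hd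
  obtain ⟨a, hxa, hda⟩ : ∃ a, O x a ∧ O d a := by
    rcases hd' with h1 | h1 | h1
    · exact absurd h1 (h.no_in d)
    · exact absurd hdW (hx d h1)
    · exact h1
  have hdI := hI d hdW hdx
  have hf := hdI.full a hda
  obtain ⟨e, hex, hed, heW, hina⟩ := hf.exists_third hxa hda hdx.symm
  have hea : O e a := (hina e).2 (by simp)
  have hax : a ≠ x := by rintro rfl; exact h.irrefl _ hxa
  have had : a ≠ d := by rintro rfl; exact h.irrefl _ hda
  set H : V → V → Prop := fun u v => v = a ∧ (u = x ∨ u = d) with hH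
  set B : V → V → Prop := fun u v => O u v ∧ ¬ H u v ∧ u ∈ W with hB
  have hBO : ∀ u v, B u v → O u v ∧ u ∈ W := fun u v h => ⟨h.1, h.2.2⟩
  have hB' : ∀ u v, O u v → u ∈ W → v ≠ a → B u v := fun u v h1 h2 h3 =>
    ⟨h1, fun h => h3 h.1, h2⟩
  have dfull : ∀ t, IsFull O W t → t ≠ a → (arcNeighbors B t).card = 3 := fun t ht hta =>
    card_arcNeighbors_full h.toSubcubicOrientation ht (fun u v h => h.1)
      (fun u hu => hB' u t hu (ht.2 u hu) hta)
  have da : (arcNeighbors B a).card = 1 := by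
    rw [Finset.card_eq_one]
    refine ⟨e, ?_⟩
    ext w
    simp only [mem_arcNeighbors, Finset.mem_singleton]
    constructor
    · rintro (h1 | h1)
      · exact absurd h1.1 (hf.sink h.toSubcubicOrientation w)
      · rcases (hina w).1 h1.1 with rfl | rfl | rfl
        · exact absurd ⟨rfl, Or.inl rfl⟩ h1.2.1
        · exact absurd ⟨rfl, Or.inr rfl⟩ h1.2.1
        · rfl
    · rintro rfl
      exact Or.inr ⟨hea, by rintro ⟨-, h1 | h1⟩ <;> contradiction, heW⟩
  have dx : (arcNeighbors B x).card = 2 := by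
    have : arcNeighbors B x = (outN O x).erase a := by
      ext w
      simp only [mem_arcNeighbors, Finset.mem_erase, mem_outN]
      constructor
      · rintro (h1 | h1)
        · exact ⟨fun e => h1.2.1 ⟨e, Or.inl rfl⟩, h1.1⟩
        · exact absurd h1.1 (h.no_in w)
      · rintro ⟨h1, h2⟩
        exact Or.inl (hB' _ _ h2 h.mem h1)
    rw [this, Finset.card_erase_of_mem (by simpa), h.card_out]
  have dxc : ∀ v, O x v → v ≠ a → (arcNeighbors B v).card ≠ 2 := by
    intro v hxv hva
    by_cases hv : IsFull O W v
    · rw [dfull v hv hva]; simp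
    · have : arcNeighbors B v = {x} := by
        ext w
        simp only [mem_arcNeighbors, Finset.mem_singleton]
        constructor
        · rintro (h1 | h1)
          · exact absurd h1.2.2 (hx v hxv)
          · by_contra hwx
            exact hv ((hI w h1.2.2 hwx).full v h1.1)
        · rintro rfl
          exact Or.inr (hB' _ _ hxv h.mem hva)
      rw [this]; simp
  refine FourColorable.of_hole h.toSubcubicOrientation hG H ?_ ?_ ?_ hE hC (inN O d) ?_ ?_
  · rintro u v ⟨rfl, rfl | rfl⟩
    · exact ⟨hxa, h.mem⟩
    · exact ⟨hda, hdW⟩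
  · refine (arcIrregular_cherry hax had hdx.symm).congr ?_
    intro u v; simp only [hH]; tauto
  · intro u v huv
    by_cases hux : u = x
    · subst hux
      rw [dx]
      exact (dxc v huv.1 (fun e => huv.2.1 ⟨e, Or.inl rfl⟩)).symm
    · have hu := hI u huv.2.2 hux
      by_cases hud : u = d
      · subst hud
        have hva : v ≠ a := fun e => huv.2.1 ⟨e, Or.inr rfl⟩
        rw [dfull v (hu.full v huv.1) hva, hu.card_arcNeighbors_of_removed
          hBO hda]
        · simp
        · intro w
          exact ⟨fun h1 => ⟨h1.1, fun e => h1.2.1 ⟨e, Or.inr rfl⟩⟩, fun h1 => hB' _ _ h1.1 hdW h1.2⟩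
      · rw [hu.card_arcNeighbors hBO]
        · by_cases hva : v = a
          · rw [hva, da]; simp
          · rw [dfull v (hu.full v huv.1) hva]; simp
        · intro w hw
          exact ⟨hw, by rintro ⟨-, h1 | h1⟩ <;> contradiction, huv.2.2⟩
  · have := h.degree_le d
    have := hdI.card_out
    omega
  · rintro u v w huv huW (hm | hm | hm | hm)
    · rcases hm.2 with h1 | h1
      · exact absurd (h1 ▸ h.mem) huW
      · exact absurd (h1 ▸ hdW) huW
    · rw [hm.1] at huv; exact absurd huv (hf.sink h.toSubcubicOrientation v)
    · rcases hm.2 with h1 | h1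
      · exact absurd (h1 ▸ huv) (h.no_in u)
      · simpa [h1] using huv
    · exact absurd (hf.2 u (hm.1 ▸ huv)) huW

omit h in
/-- If `c` meets at least four vertices, at most one of which does not reach it through `s` or
`s'`, and at most one of which reaches it through `s`, then `s'` is full. -/
theorem full_of_meeting (hO : SubcubicOrientation O) {c q g s s' : V}
    (h4 : 4 ≤ (meeting O W c).card) (hc : c ∈ W) (hs' : O c s')
    (hsub : ∀ u ∈ meeting O W c, u = q ∨ O u s ∨ O u s')
    (hg : ∀ u ∈ W, u ≠ c → O u s → u = g) :
    IsFull O W s' ∧ (g ∈ W → g ≠ c → ¬ O g s') ∧ (q ∈ W → q ≠ c → ¬ O q s') ∧ q ≠ g ∧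
      ∃ u ∈ W, u ≠ c ∧ O u s := by
  set M := (inN O s' ∩ W).erase c with hM
  have e1 : M.card + 1 = (inN O s' ∩ W).card := Finset.card_erase_add_one (by simp [hs', hc])
  have e2 : (inN O s' ∩ W).card ≤ (inN O s').card := Finset.card_le_card Finset.inter_subset_left
  have e3 := hO.degree_le s'
  have hm : ∀ u ∈ meeting O W c, u = q ∨ (u = g ∧ ∃ u ∈ W, u ≠ c ∧ O u s) ∨ u ∈ M := by
    intro u hu
    obtain ⟨h1, h2, -⟩ := mem_meeting.1 hu
    rcases hsub u hu with h3 | h3 | h3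
    · exact Or.inl h3
    · exact Or.inr (Or.inl ⟨hg u h1 h2 h3, u, h1, h2, h3⟩)
    · exact Or.inr (Or.inr (by simp [hM, h1, h2, h3]))
  -- `M` has at most two elements, so a single further vertex cannot account for four meetings. Each
  -- coincidence excluded below would reduce to this.
  have one : ∀ v, (∀ u ∈ meeting O W c, u ∈ insert v M) → False := by
    intro v hv
    have h1 := Finset.card_le_card hv
    have h2 := Finset.card_insert_le v M
    omega
  have two : meeting O W c ⊆ insert q (insert g M) := by
    intro u hu; have := hm u hu; simp only [Finset.mem_insert]; tauto
  have h5 := Finset.card_le_card two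
  have h6 := Finset.card_insert_le q (insert g M)
  have h7 := Finset.card_insert_le g M
  have hfull : inN O s' ∩ W = inN O s' :=
    Finset.eq_of_subset_of_card_le Finset.inter_subset_left (by omega)
  refine ⟨⟨by omega, ?_⟩, ?_, ?_, ?_, ?_⟩
  · intro u hu
    have : u ∈ inN O s' ∩ W := by rw [hfull]; simpa
    exact (Finset.mem_inter.1 this).2
  · intro hgW hgc hgs
    have : g ∈ M := by simp [hM, hgW, hgc, hgs]
    refine one q fun u hu => ?_
    rcases hm u hu with h1 | ⟨rfl, -⟩ | h1 <;> simp_all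
  · intro hqW hqc hqs
    have : q ∈ M := by simp [hM, hqW, hqc, hqs]
    refine one g fun u hu => ?_
    rcases hm u hu with rfl | ⟨h1, -⟩ | h1 <;> simp_all
  · rintro rfl
    refine one q fun u hu => ?_
    rcases hm u hu with h1 | ⟨h1, -⟩ | h1 <;> simp_all
  · by_contra hne
    refine one q fun u hu => ?_
    rcases hm u hu with h1 | ⟨-, h1⟩ | h1
    · simp_all
    · exact absurd h1 hne
    · exact Finset.mem_insert_of_mem h1

omit h in
-- With nobody arriving through `s`, there would be at most `q` and two tails through `s'`, three in
-- all.
theorem exists_of_meeting (hO : SubcubicOrientation O) {c q s s' : V}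
    (h4 : 4 ≤ (meeting O W c).card) (hc : c ∈ W) (hs' : O c s')
    (hsub : ∀ u ∈ meeting O W c, u = q ∨ O u s ∨ O u s') : ∃ u ∈ W, u ≠ c ∧ O u s := by
  by_contra hne
  push Not at hne
  have := full_of_meeting (g := q) hO h4 hc hs' hsub
    (fun u hu huc hus => absurd hus (hne u hu huc))
  exact this.2.2.2.1 rfl

/-- A vertex of the core with a parent but no child in the core. -/
theorem leaf_structure {l q : V} (hl : l ∈ W) (hlx : l ≠ x) (hq : O q l)
    (hchild : ∀ y, O l y → y ∉ W) : ∃ s s', s ≠ s' ∧ (∀ z, O l z ↔ z = s ∨ z = s') ∧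
      (∀ z, ¬ O s z) ∧ (∀ z, ¬ O s' z) ∧ (∀ u ∈ meeting O W l, u = q ∨ O u s ∨ O u s') := by
  obtain ⟨s, s', hss, ho⟩ := exists_of_card_two (h.card_two hl hlx)
  have hls : O l s := (ho s).2 (Or.inl rfl)
  have hls' : O l s' := (ho s').2 (Or.inr rfl)
  have hsub : ∀ u ∈ meeting O W l, u = q ∨ O u s ∨ O u s' := by
    intro u hu
    obtain ⟨h1, h2, h3 | h3 | ⟨z, h3, h5⟩⟩ := mem_meeting.1 hu
    · exact Or.inl (h.unique_parent hl hq h3)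
    · exact absurd h1 (hchild u h3)
    · rcases (ho z).1 h3 with rfl | rfl <;> tauto
  have h4 := h.core.four_le l hl (by simp)
  -- A second in-neighbour leaves out-degree at most 1, hence 0 by parity.
  have hsink : ∀ s, O l s → (∃ u ∈ W, u ≠ l ∧ O u s) → ∀ z, ¬ O s z := by
    rintro s hs ⟨u, -, hul, hus⟩ z hz
    have h1 : ({l, u} : Finset V) ⊆ inN O s := by
      intro w hw; simp at hw; rcases hw with rfl | rfl <;> simpa
    have h2 := Finset.card_le_card h1
    rw [Finset.card_pair hul.symm] at h2
    have h3 := h.degree_le s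
    have h5 : 0 < (outN O s).card := Finset.card_pos.2 ⟨z, by simpa⟩
    have hsx : s ≠ x := by rintro rfl; exact h.no_in _ hs
    have := h.card_out_of_ne s hsx
    omega
  exact ⟨s, s', hss, ho,
    hsink s hls (exists_of_meeting h.toSubcubicOrientation h4 hl hls' hsub),
    hsink s' hls' (exists_of_meeting h.toSubcubicOrientation h4 hl hls
      (fun u hu => by have := hsub u hu; tauto)), hsub⟩

/-- If `x` has a child in the core and two children that are sinks. -/
theorem center_structure {y : V} (hy : y ∈ W) (hxy : O x y) (hj : 2 ≤ sinkCount O x) :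
    ∃ a b, a ≠ b ∧ a ≠ y ∧ b ≠ y ∧ (∀ z, O x z ↔ z = y ∨ z = a ∨ z = b) ∧ (∀ z, ¬ O a z) ∧
      (∀ z, ¬ O b z) ∧ (∀ u ∈ meeting O W x, u = y ∨ O u a ∨ O u b) := by
  have hc : ((outN O x).erase y).card = 2 := by
    rw [Finset.card_erase_of_mem (by simpa), h.card_out]
  have hy' : outN O y ≠ ∅ := (h.nonempty y hy).ne_empty
  have hsub : {s ∈ outN O x | outN O s = ∅} ⊆ (outN O x).erase y := by
    intro s hs
    simp only [Finset.mem_filter] at hs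
    refine Finset.mem_erase.2 ⟨?_, hs.1⟩
    rintro rfl; exact hy' hs.2
  -- Since `y` is not a sink, two sinks among three children are all the children other than `y`.
  have heq := Finset.eq_of_subset_of_card_le hsub (by rw [hc]; exact hj)
  obtain ⟨a, b, hab, e⟩ := Finset.card_eq_two.1 hc
  have he : ∀ z, (z ≠ y ∧ O x z) ↔ z = a ∨ z = b := by
    intro z
    have := Finset.ext_iff.1 e z
    simpa using this
  have hs : ∀ s, s ∈ (outN O x).erase y → ∀ z, ¬ O s z := by
    intro s hs
    rw [← heq] at hs
    exact outN_eq_empty.1 (Finset.mem_filter.1 hs).2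
  have ha := (he a).2 (Or.inl rfl)
  have hb := (he b).2 (Or.inr rfl)
  have sa := hs a (by rw [e]; simp)
  have sb := hs b (by rw [e]; simp)
  refine ⟨a, b, hab, ha.1, hb.1, ?_, sa, sb, ?_⟩
  · intro z
    have := he z
    by_cases hz : z = y
    · subst hz; tauto
    · tauto
  · intro u hu
    obtain ⟨h1, h2, h3 | h3 | ⟨z, h3, h5⟩⟩ := mem_meeting.1 hu
    · exact absurd h3 (h.no_in u)
    · by_cases huy : u = y
      · exact Or.inl huy
      · rcases (he u).1 ⟨huy, h3⟩ with rfl | rfl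
        · exact absurd h1 (h.not_mem_of_sink sa)
        · exact absurd h1 (h.not_mem_of_sink sb)
    · by_cases hzy : z = y
      · subst hzy; exact absurd (h.unique_parent hy hxy h5) h2
      · rcases (he z).1 ⟨hzy, h3⟩ with rfl | rfl <;> tauto

end IsClawCore

end Claw

/-! ### Claw core in which the core child of the centre is a leaf -/

section ClawLeaf

theorem spider_closure {V : Type*} (l x s d s' d' u v : V) :
    (Spider l x s d s' d' u v ∨ Spider l x s d s' d' v u) ↔
      (((u = x ∧ v = l) ∨ (u = l ∧ (v = s ∨ v = s')) ∨ (u = d ∧ v = s) ∨ (u = d' ∧ v = s')) ∨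
        ((v = x ∧ u = l) ∨ (v = l ∧ (u = s ∨ u = s')) ∨ (v = d ∧ u = s) ∨ (v = d' ∧ u = s'))) := by
  unfold Spider; tauto

open scoped Classical

variable {V : Type*} [Fintype V] {O : V → V → Prop} {G : SimpleGraph V} {W C : Finset V} {x : V}

namespace IsClawCore

variable (h : IsClawCore O x W)
include h

/-- Counting at `x` and at `l` makes all four sinks `a`, `b`, `s`, `s'` full. A spider centred at
`l` is cut out, with the short leg to `x` and long legs through `s` and `s'`. This removes `l` from
the base and lowers `x` to 2 and `s`, `s'` to 1. -/
theorem fourColorable_of_leaf (hG : ∀ u v, G.Adj u v ↔ O u v ∨ O v u)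
    (hE : Extends O W C) (hC : ∀ u v, O u v → u ∈ C) {l : V} (hl : l ∈ W) (hxl : O x l)
    (hchild : ∀ y, O l y → y ∉ W) (hj : 2 ≤ sinkCount O x) : FourColorable G := by
  have hO := h.toSubcubicOrientation
  have hlx : l ≠ x := by rintro rfl; exact h.irrefl _ hxl
  obtain ⟨s, s', hss, hlo, hsk, hsk', hml⟩ := h.leaf_structure hl hlx hxl hchild
  obtain ⟨a, b, hab, hal, hbl, hxo, hak, hbk, hmx⟩ := h.center_structure hl hxl hj
  have hxa : O x a := (hxo a).2 (by simp)
  have hxb : O x b := (hxo b).2 (by simp)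
  have hls : O l s := (hlo s).2 (by simp)
  have hls' : O l s' := (hlo s').2 (by simp)
  have hsW := h.not_mem_of_sink hsk
  have hsW' := h.not_mem_of_sink hsk'
  have haW := h.not_mem_of_sink hak
  have hbW := h.not_mem_of_sink hbk
  have hI : ∀ c ∈ W, c ≠ x → c ≠ l → IsIsolated O W c := by
    intro c hc hcx hcl
    have hxc : ¬ O x c := by
      intro hxc
      rcases (hxo c).1 hxc with rfl | rfl | rfl <;> contradiction
    refine h.isolated hc hcx ?_ ?_
    · intro y hy hyW
      exact hxc (h.structure_of_child hc hcx hyW hy).1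
    · intro p hpc hp
      by_cases hpx : p = x
      · exact hxc (hpx ▸ hpc)
      · have := (h.structure_of_child hp hpx hc hpc).1
        rcases (hxo p).1 this with rfl | rfl | rfl
        · exact hchild _ hpc hc
        · exact haW hp
        · exact hbW hp
  -- The adjacent pair `x`, `l` accounts for one meeting only, even if both point to `t`. So an
  -- isolated tail must arrive through each sink, and that makes the sink full.
  have touch : ∀ c q t t', c ∈ W → (c = x ∧ q = l ∨ c = l ∧ q = x) → O c t' →
      (∀ u ∈ meeting O W c, u = q ∨ O u t ∨ O u t') → ∃ d ∈ W, d ≠ x ∧ d ≠ l ∧ O d t := by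
    intro c q t t' hc hcq ht' hsub
    by_contra hne
    push Not at hne
    have := (full_of_meeting (g := q) hO (h.core.four_le c hc (by simp)) hc ht' hsub
      (by
        intro u hu huc hut
        by_contra huq
        rcases hcq with ⟨rfl, rfl⟩ | ⟨rfl, rfl⟩
        · exact hne u hu huc huq hut
        · exact hne u hu huq huc hut))
    exact this.2.2.2.1 rfl
  obtain ⟨d, hdW, hdx, hdl, hds⟩ := touch l x s s' hl (Or.inr ⟨rfl, rfl⟩) hls' hml
  obtain ⟨d', hdW', hdx', hdl', hds'⟩ := touch l x s' s hl (Or.inr ⟨rfl, rfl⟩) hls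
    (fun u hu => by have := hml u hu; tauto)
  obtain ⟨da, hdaW, hdax, hdal, hda⟩ := touch x l a b h.mem (Or.inl ⟨rfl, rfl⟩) hxb hmx
  obtain ⟨db, hdbW, hdbx, hdbl, hdb⟩ := touch x l b a h.mem (Or.inl ⟨rfl, rfl⟩) hxa
    (fun u hu => by have := hmx u hu; tauto)
  have hdI := hI d hdW hdx hdl
  have hdI' := hI d' hdW' hdx' hdl'
  have fs := hdI.full s hds
  have fs' := hdI'.full s' hds'
  have fa := (hI da hdaW hdax hdal).full a hda
  have fb := (hI db hdbW hdbx hdbl).full b hdb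
  have nds : ¬ O d s' := fun h1 => hdl (hdI.unique s s' l hds h1 hss hls hls').symm
  have nds' : ¬ O d' s := fun h1 => hdl' (hdI'.unique s s' l h1 hds' hss hls hls').symm
  have hdd : d ≠ d' := by rintro rfl; exact nds hds'
  obtain ⟨e, hel, hed, heW, hins⟩ := fs.exists_third hls hds hdl.symm
  obtain ⟨e', hel', hed', heW', hins'⟩ := fs'.exists_third hls' hds' hdl'.symm
  -- The tails `d` and `d'` are distinct because an isolated `d` shares only one head with `l`; this
  -- keeps the hole a tree. Outside the core only the parents of `d` and `d'` touch it.
  set H : V → V → Prop := fun u v => (u = x ∧ v = l) ∨ (u = l ∧ (v = s ∨ v = s')) ∨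
    (u = d ∧ v = s) ∨ (u = d' ∧ v = s') with hH
  set B : V → V → Prop := fun u v => O u v ∧ ¬ H u v ∧ u ∈ W with hB
  have hBO : ∀ u v, B u v → O u v ∧ u ∈ W := fun u v h => ⟨h.1, h.2.2⟩
  have hB' : ∀ u v, O u v → u ∈ W → v ≠ s → v ≠ s' → v ≠ l → B u v := fun u v h1 h2 h3 h4 h5 =>
    ⟨h1, by rintro (⟨-, h⟩ | ⟨-, h | h⟩ | ⟨-, h⟩ | ⟨-, h⟩) <;> contradiction, h2⟩
  have fl : ∀ t, IsFull O W t → t ≠ l := by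
    rintro t ht rfl; exact ht.sink hO _ hls
  have dfull : ∀ t, IsFull O W t → t ≠ s → t ≠ s' → (arcNeighbors B t).card = 3 :=
    fun t ht h1 h2 => card_arcNeighbors_full hO ht (fun u v h => h.1)
      (fun u hu => hB' u t hu (ht.2 u hu) h1 h2 (fl t ht))
  have ds : (arcNeighbors B s).card = 1 := by
    rw [Finset.card_eq_one]
    refine ⟨e, ?_⟩
    ext w
    simp only [mem_arcNeighbors, Finset.mem_singleton]
    constructor
    · rintro (h1 | h1)
      · exact absurd h1.1 (hsk w)
      · rcases (hins w).1 h1.1 with rfl | rfl | rfl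
        · exact absurd (by simp [hH]) h1.2.1
        · exact absurd (by simp [hH]) h1.2.1
        · rfl
    · rintro rfl
      refine Or.inr ⟨(hins w).2 (by simp), ?_, heW⟩
      have := fl s fs
      rintro (⟨-, h⟩ | ⟨h, -⟩ | ⟨h, -⟩ | ⟨-, h⟩) <;> contradiction
  have ds' : (arcNeighbors B s').card = 1 := by
    rw [Finset.card_eq_one]
    refine ⟨e', ?_⟩
    ext w
    simp only [mem_arcNeighbors, Finset.mem_singleton]
    constructor
    · rintro (h1 | h1)
      · exact absurd h1.1 (hsk' w)
      · rcases (hins' w).1 h1.1 with rfl | rfl | rfl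
        · exact absurd (by simp [hH]) h1.2.1
        · exact absurd (by simp [hH]) h1.2.1
        · rfl
    · rintro rfl
      refine Or.inr ⟨(hins' w).2 (by simp), ?_, heW'⟩
      have := fl s' fs'
      rintro (⟨-, h⟩ | ⟨h, -⟩ | ⟨-, h⟩ | ⟨h, -⟩) <;> [skip; skip; exact absurd h.symm hss; skip] <;>
        contradiction
  have dne : ∀ t, IsFull O W t → (arcNeighbors B t).card ≠ 2 := by
    intro t ht
    by_cases h1 : t = s
    · rw [h1, ds]; simp
    · by_cases h2 : t = s'
      · rw [h2, ds']; simp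
      · rw [dfull t ht h1 h2]; simp
  have dx : (arcNeighbors B x).card = 2 := by
    have : arcNeighbors B x = (outN O x).erase l := by
      ext w
      simp only [mem_arcNeighbors, Finset.mem_erase, mem_outN]
      constructor
      · rintro (h1 | h1)
        · exact ⟨fun e => h1.2.1 (Or.inl ⟨rfl, e⟩), h1.1⟩
        · exact absurd h1.1 (h.no_in w)
      · rintro ⟨h1, h2⟩
        refine Or.inl ⟨h2, ?_, h.mem⟩
        rintro (⟨-, h⟩ | ⟨h, -⟩ | ⟨h, -⟩ | ⟨h, -⟩)
        · exact h1 h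
        · exact hlx h.symm
        · exact hdx h.symm
        · exact hdx' h.symm
    rw [this, Finset.card_erase_of_mem (by simpa), h.card_out]
  refine FourColorable.of_hole hO hG H ?_ ?_ ?_ hE hC (inN O d ∪ inN O d') ?_ ?_
  · rintro u v (⟨rfl, rfl⟩ | ⟨rfl, rfl | rfl⟩ | ⟨rfl, rfl⟩ | ⟨rfl, rfl⟩)
    · exact ⟨hxl, h.mem⟩
    all_goals exact ⟨by assumption, by assumption⟩
  · refine (arcIrregular_spider (r := l) (a := x) (v₁ := s) (w₁ := d) (v₂ := s') (w₂ := d') ?_).congr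
      ?_
    · have : ∀ t c, t ∉ W → c ∈ W → c ≠ t := by rintro t c h1 h2 rfl; exact h1 h2
      have i1 := this s l hsW hl
      have i2 := this s' l hsW' hl
      have i3 := this s x hsW h.mem
      have i4 := this s' x hsW' h.mem
      have i5 := this s d hsW hdW
      have i6 := this s' d hsW' hdW
      have i7 := this s d' hsW hdW'
      have i8 := this s' d' hsW' hdW'
      simp only [List.nodup_cons, List.mem_cons, List.not_mem_nil, or_false, not_or,
        not_false_eq_true, List.nodup_nil, and_true]
      exact ⟨⟨hlx, i1, hdl.symm, i2, hdl'.symm⟩, ⟨i3, hdx.symm, i4, hdx'.symm⟩,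
        ⟨i5.symm, hss, i7.symm⟩, ⟨i6, hdd⟩, i8.symm⟩
    · exact spider_closure l x s d s' d'
  · intro u v huv
    have huW := huv.2.2
    by_cases hux : u = x
    · subst hux
      rw [dx]
      rcases (hxo v).1 huv.1 with rfl | rfl | rfl
      · exact absurd (Or.inl ⟨rfl, rfl⟩) huv.2.1
      · exact (dne _ fa).symm
      · exact (dne _ fb).symm
    by_cases hul : u = l
    · subst hul
      exact absurd (Or.inr (Or.inl ⟨rfl, (hlo v).1 huv.1⟩)) huv.2.1
    have hu := hI u huW hux hul
    have hv := hu.full v huv.1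
    by_cases hud : u = d
    · subst hud
      have hvs : v ≠ s := by rintro rfl; exact huv.2.1 (by simp [hH])
      have hvs' : v ≠ s' := by rintro rfl; exact nds huv.1
      rw [dfull v hv hvs hvs', hu.card_arcNeighbors_of_removed hBO hds]
      · simp
      · intro w
        refine ⟨fun h1 => ⟨h1.1, fun e => h1.2.1 (by simp [hH, e])⟩, fun h1 => ⟨h1.1, ?_, huW⟩⟩
        rintro (⟨h, -⟩ | ⟨h, -⟩ | ⟨-, h⟩ | ⟨h, -⟩)
        · exact hux h
        · exact hul h
        · exact h1.2 h
        · exact hdd h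
    by_cases hud' : u = d'
    · subst hud'
      have hvs' : v ≠ s' := by rintro rfl; exact huv.2.1 (by simp [hH])
      have hvs : v ≠ s := by rintro rfl; exact nds' huv.1
      rw [dfull v hv hvs hvs', hu.card_arcNeighbors_of_removed hBO hds']
      · simp
      · intro w
        refine ⟨fun h1 => ⟨h1.1, fun e => h1.2.1 (by simp [hH, e])⟩, fun h1 => ⟨h1.1, ?_, huW⟩⟩
        rintro (⟨h, -⟩ | ⟨h, -⟩ | ⟨h, -⟩ | ⟨-, h⟩)
        · exact hux h
        · exact hul h
        · exact hud h
        · exact h1.2 h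
    rw [hu.card_arcNeighbors hBO]
    · exact (dne v hv).symm
    · intro w hw
      refine ⟨hw, ?_, huW⟩
      rintro (⟨h, -⟩ | ⟨h, -⟩ | ⟨h, -⟩ | ⟨h, -⟩) <;> contradiction
  · have h1 := hO.degree_le d
    have h2 := hO.degree_le d'
    have h3 := hdI.card_out
    have h4 := hdI'.card_out
    have := Finset.card_union_le (inN O d) (inN O d')
    omega
  · intro u v w huv huW hm
    have hxW := h.mem
    simp only [Finset.mem_union, mem_inN]
    rcases hm with hm | hm | hm | hm
    · exfalso
      rcases hm with ⟨rfl, -⟩ | ⟨rfl, -⟩ | ⟨rfl, -⟩ | ⟨rfl, -⟩ <;> contradiction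
    · exfalso
      rcases hm with ⟨-, rfl⟩ | ⟨-, rfl | rfl⟩ | ⟨-, rfl⟩ | ⟨-, rfl⟩
      · contradiction
      · exact hsk _ huv
      · exact hsk' _ huv
      · exact hsk _ huv
      · exact hsk' _ huv
    · rcases hm with ⟨rfl, -⟩ | ⟨rfl, -⟩ | ⟨rfl, -⟩ | ⟨rfl, -⟩
      · exact absurd huv (h.no_in u)
      · rw [h.unique_parent hl hxl huv] at huW; contradiction
      · exact Or.inl huv
      · exact Or.inr huv
    · exfalso
      rcases hm with ⟨-, rfl⟩ | ⟨-, rfl | rfl⟩ | ⟨-, rfl⟩ | ⟨-, rfl⟩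
      · rw [h.unique_parent hl hxl huv] at huW; contradiction
      · exact huW (fs.2 u huv)
      · exact huW (fs'.2 u huv)
      · exact huW (fs.2 u huv)
      · exact huW (fs'.2 u huv)

end IsClawCore

end ClawLeaf

/-! ### Claw core containing a directed path of two arcs, and the general claw -/

section ClawGrandchild

open scoped Classical

variable {V : Type*} [Fintype V] {O : V → V → Prop} {G : SimpleGraph V} {W C : Finset V} {x : V}

namespace IsClawCore

variable (h : IsClawCore O x W)
include h

theorem isolated_of_path {p l s₁ a b : V} (hxo : ∀ z, O x z ↔ z = p ∨ z = a ∨ z = b)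
    (hpo : ∀ z, O p z ↔ z = l ∨ z = s₁) (haW : a ∉ W) (hbW : b ∉ W) (hs₁ : s₁ ∉ W)
    (hchild : ∀ y, O l y → y ∉ W) {c : V} (hc : c ∈ W) (hcx : c ≠ x) (hcp : c ≠ p) (hcl : c ≠ l) :
    IsIsolated O W c := by
  have hxc : ¬ O x c := by
    intro hxc
    rcases (hxo c).1 hxc with rfl | rfl | rfl <;> contradiction
  refine h.isolated hc hcx ?_ ?_
  · intro y hy hyW
    exact hxc (h.structure_of_child hc hcx hyW hy).1
  · intro q hqc hq
    by_cases hqx : q = x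
    · exact hxc (hqx ▸ hqc)
    · have := (h.structure_of_child hq hqx hc hqc).1
      rcases (hxo q).1 this with rfl | rfl | rfl
      · rcases (hpo c).1 hqc with rfl | rfl <;> contradiction
      · exact haW hq
      · exact hbW hq

/-- Once the cherry `x → p → l` is cut out, every remaining core arc runs from a tail of degree at
most 2 to a full head of degree 3. The cherry touches no out-star from outside the core. -/
theorem fourColorable_of_path_of_full (hG : ∀ u v, G.Adj u v ↔ O u v ∨ O v u)
    (hE : Extends O W C) (hC : ∀ u v, O u v → u ∈ C) {p l s₁ a b s s' : V} (hp : p ∈ W)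
    (hl : l ∈ W) (hxo : ∀ z, O x z ↔ z = p ∨ z = a ∨ z = b) (hpo : ∀ z, O p z ↔ z = l ∨ z = s₁)
    (hlo : ∀ z, O l z ↔ z = s ∨ z = s') (hss : s ≠ s')
    (hI : ∀ c ∈ W, c ≠ x → c ≠ p → c ≠ l → IsIsolated O W c)
    (fa : IsFull O W a) (fb : IsFull O W b) (fs : IsFull O W s) (fs' : IsFull O W s')
    (fs₁ : IsFull O W s₁) : FourColorable G := by
  have hO := h.toSubcubicOrientation
  have hxp : O x p := (hxo p).2 (by simp)
  have hpl : O p l := (hpo l).2 (by simp)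
  have hpx : p ≠ x := by rintro rfl; exact h.irrefl _ hxp
  have hlp : l ≠ p := by rintro rfl; exact h.irrefl _ hpl
  have hlx : l ≠ x := by rintro rfl; exact h.no_in _ hpl
  have hls : O l s := (hlo s).2 (by simp)
  set H : V → V → Prop := fun u v => (u = x ∧ v = p) ∨ (u = p ∧ v = l) with hH
  set B : V → V → Prop := fun u v => O u v ∧ ¬ H u v ∧ u ∈ W with hB
  have hBO : ∀ u v, B u v → O u v ∧ u ∈ W := fun u v h => ⟨h.1, h.2.2⟩
  have dfull : ∀ t, IsFull O W t → (arcNeighbors B t).card = 3 := fun t ht =>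
    card_arcNeighbors_full hO ht (fun u v h => h.1) (fun u hu => ⟨hu, by
      rintro (⟨-, rfl⟩ | ⟨-, rfl⟩)
      · exact ht.sink hO _ hpl
      · exact ht.sink hO _ hls, ht.2 u hu⟩)
  have dx : (arcNeighbors B x).card = 2 := by
    have : arcNeighbors B x = (outN O x).erase p := by
      ext w
      simp only [mem_arcNeighbors, Finset.mem_erase, mem_outN]
      constructor
      · rintro (h1 | h1)
        · exact ⟨fun e => h1.2.1 (Or.inl ⟨rfl, e⟩), h1.1⟩
        · exact absurd h1.1 (h.no_in w)
      · rintro ⟨h1, h2⟩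
        refine Or.inl ⟨h2, ?_, h.mem⟩
        rintro (⟨-, h⟩ | ⟨h, -⟩)
        · exact h1 h
        · exact hpx h.symm
    rw [this, Finset.card_erase_of_mem (by simpa), h.card_out]
  have dp : (arcNeighbors B p).card ≤ 2 := by
    refine (Finset.card_le_card (t := {s₁}) ?_).trans (by simp)
    intro w
    simp only [mem_arcNeighbors, Finset.mem_singleton]
    rintro (h1 | h1)
    · rcases (hpo w).1 h1.1 with rfl | rfl
      · exact absurd (Or.inr ⟨rfl, rfl⟩) h1.2.1
      · rfl
    · have := h.unique_parent hp hxp h1.1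
      exact absurd (Or.inl ⟨this, rfl⟩) h1.2.1
  have dl : (arcNeighbors B l).card ≤ 2 := by
    refine (Finset.card_le_card (t := {s, s'}) ?_).trans (by rw [Finset.card_pair hss])
    intro w
    simp only [mem_arcNeighbors, Finset.mem_singleton, Finset.mem_insert]
    rintro (h1 | h1)
    · exact (hlo w).1 h1.1
    · have := h.unique_parent hl hpl h1.1
      exact absurd (Or.inr ⟨this, rfl⟩) h1.2.1
  refine FourColorable.of_hole hO hG H ?_ ?_ ?_ hE hC ∅ (by simp) ?_
  · rintro u v (⟨rfl, rfl⟩ | ⟨rfl, rfl⟩)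
    · exact ⟨hxp, h.mem⟩
    · exact ⟨hpl, hp⟩
  · refine (arcIrregular_cherry hpx hlp.symm hlx.symm).congr ?_
    intro u v
    simp only [hH]
    constructor
    · rintro ((h | h) | (h | h))
      · exact Or.inr (Or.inl ⟨h.2, h.1⟩)
      · exact Or.inl (Or.inr h)
      · exact Or.inl (Or.inl ⟨h.2, h.1⟩)
      · exact Or.inr (Or.inr h)
    · rintro ((h | h) | (h | h))
      · exact Or.inr (Or.inl ⟨h.2, h.1⟩)
      · exact Or.inl (Or.inr h)
      · exact Or.inl (Or.inl ⟨h.2, h.1⟩)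
      · exact Or.inr (Or.inr h)
  · intro u v huv
    have huW := huv.2.2
    have hv : IsFull O W v := by
      by_cases hux : u = x
      · subst hux
        rcases (hxo v).1 huv.1 with rfl | rfl | rfl
        · exact absurd (Or.inl ⟨rfl, rfl⟩) huv.2.1
        · exact fa
        · exact fb
      by_cases hup : u = p
      · subst hup
        rcases (hpo v).1 huv.1 with rfl | rfl
        · exact absurd (Or.inr ⟨rfl, rfl⟩) huv.2.1
        · exact fs₁
      by_cases hul : u = l
      · subst hul
        rcases (hlo v).1 huv.1 with rfl | rfl <;> assumption
      exact (hI u huW hux hup hul).full v huv.1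
    have hu : (arcNeighbors B u).card ≤ 2 := by
      by_cases hux : u = x
      · rw [hux, dx]
      by_cases hup : u = p
      · rwa [hup]
      by_cases hul : u = l
      · rwa [hul]
      rw [(hI u huW hux hup hul).card_arcNeighbors hBO]
      intro w hw
      refine ⟨hw, ?_, huW⟩
      rintro (⟨h, -⟩ | ⟨h, -⟩) <;> contradiction
    change (arcNeighbors B u).card ≠ (arcNeighbors B v).card
    rw [dfull v hv]
    omega
  · intro u v w huv huW hm
    exfalso
    have hxW := h.mem
    rcases hm with hm | hm | hm | hm
    · rcases hm with ⟨rfl, -⟩ | ⟨rfl, -⟩ <;> contradiction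
    · rcases hm with ⟨-, rfl⟩ | ⟨-, rfl⟩ <;> contradiction
    · rcases hm with ⟨rfl, -⟩ | ⟨rfl, -⟩
      · exact h.no_in u huv
      · rw [h.unique_parent hp hxp huv] at huW; contradiction
    · rcases hm with ⟨-, rfl⟩ | ⟨-, rfl⟩
      · rw [h.unique_parent hp hxp huv] at huW; contradiction
      · rw [h.unique_parent hl hpl huv] at huW; contradiction

set_option maxHeartbeats 1000000 in
-- A sink `a` that is not full is reached from the core only by `x` and `l`. Counting at these two
-- then makes `b` and `s'` full. A spider centred at `l` is cut out, with legs `a`, `p`–`x` and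
-- `s'`–`d`; it leaves `a` with the single arc from `x`, which keeps degree 2.
theorem fourColorable_of_path_of_not_full (hG : ∀ u v, G.Adj u v ↔ O u v ∨ O v u)
    (hE : Extends O W C) (hC : ∀ u v, O u v → u ∈ C) {p l s₁ a b s' : V} (hp : p ∈ W)
    (hl : l ∈ W) (hxo : ∀ z, O x z ↔ z = p ∨ z = a ∨ z = b) (hpo : ∀ z, O p z ↔ z = l ∨ z = s₁)
    (hlo : ∀ z, O l z ↔ z = a ∨ z = s') (has' : a ≠ s') (hab : a ≠ b) (hap : a ≠ p) (hbp : b ≠ p)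
    (hls₁ : l ≠ s₁)
    (hI : ∀ c ∈ W, c ≠ x → c ≠ p → c ≠ l → IsIsolated O W c)
    (fs₁ : IsFull O W s₁) (nfa : ¬ IsFull O W a) (hak : ∀ z, ¬ O a z)
    (hina : ∀ u ∈ W, O u a → u = x ∨ u = l)
    (hmx : ∀ u ∈ meeting O W x, u = p ∨ O u a ∨ O u b)
    (hml : ∀ u ∈ meeting O W l, u = p ∨ O u a ∨ O u s') : FourColorable G := by
  have hO := h.toSubcubicOrientation
  have hxp : O x p := (hxo p).2 (by simp)
  have hxa : O x a := (hxo a).2 (by simp)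
  have hxb : O x b := (hxo b).2 (by simp)
  have hpl : O p l := (hpo l).2 (by simp)
  have hps₁ : O p s₁ := (hpo s₁).2 (by simp)
  have hpx : p ≠ x := by rintro rfl; exact h.irrefl _ hxp
  have hlp : l ≠ p := by rintro rfl; exact h.irrefl _ hpl
  have hlx : l ≠ x := by rintro rfl; exact h.no_in _ hpl
  have hla : O l a := (hlo a).2 (by simp)
  have hls' : O l s' := (hlo s').2 (by simp)
  have haW := h.not_mem_of_sink hak
  obtain ⟨fb, hlb, -, -, -⟩ := full_of_meeting (g := l) hO (h.core.four_le x h.mem (by simp)) h.mem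
    hxb hmx (fun u hu hux hua => (hina u hu hua).resolve_left hux)
  have h4l := h.core.four_le l hl (by simp)
  obtain ⟨fs', hxs', hps', -, -⟩ := full_of_meeting (g := x) hO h4l hl
    hls' hml (fun u hu hul hua => (hina u hu hua).resolve_right hul)
  replace hlb := hlb hl hlx
  replace hxs' := hxs' h.mem hlx.symm
  replace hps' := hps' hp hlp.symm
  have hsk' := fs'.sink hO
  have hsW' := h.not_mem_of_sink hsk'
  obtain ⟨d, hdW, hdl, hds⟩ := exists_of_meeting hO h4l hl hla
    (fun u hu => by have := hml u hu; tauto)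
  have hdx : d ≠ x := by rintro rfl; exact hxs' hds
  have hdp : d ≠ p := by rintro rfl; exact hps' hds
  have hdI := hI d hdW hdx hdp hdl
  obtain ⟨e, hel, hed, heW, hins⟩ := fs'.exists_third hls' hds hdl.symm
  have hbs' : b ≠ s' := by rintro rfl; exact hlb hls'
  have hs₁s' : s₁ ≠ s' := by rintro rfl; exact hps' hps₁
  have hs'p : s' ≠ p := by rintro rfl; exact hsk' _ hpl
  have hs'l : s' ≠ l := by rintro rfl; exact hsk' _ hls'
  set H : V → V → Prop := fun u v => (u = x ∧ v = p) ∨ (u = p ∧ v = l) ∨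
    (u = l ∧ (v = a ∨ v = s')) ∨ (u = d ∧ v = s') with hH
  set B : V → V → Prop := fun u v => O u v ∧ ¬ H u v ∧ u ∈ W with hB
  have hBO : ∀ u v, B u v → O u v ∧ u ∈ W := fun u v h => ⟨h.1, h.2.2⟩
  have dfull : ∀ t, IsFull O W t → t ≠ s' → (arcNeighbors B t).card = 3 := fun t ht hts =>
    card_arcNeighbors_full hO ht (fun u v h => h.1) (fun u hu => ⟨hu, by
      rintro (⟨-, rfl⟩ | ⟨-, rfl⟩ | ⟨-, rfl | rfl⟩ | ⟨-, rfl⟩)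
      · exact ht.sink hO _ hpl
      · exact ht.sink hO _ hls'
      · exact nfa ht
      · exact hts rfl
      · exact hts rfl, ht.2 u hu⟩)
  have ds' : (arcNeighbors B s').card = 1 := by
    rw [Finset.card_eq_one]
    refine ⟨e, ?_⟩
    ext w
    simp only [mem_arcNeighbors, Finset.mem_singleton]
    constructor
    · rintro (h1 | h1)
      · exact absurd h1.1 (hsk' w)
      · rcases (hins w).1 h1.1 with rfl | rfl | rfl
        · exact absurd (by simp [hH]) h1.2.1
        · exact absurd (by simp [hH]) h1.2.1
        · rfl
    · rintro rfl
      refine Or.inr ⟨(hins w).2 (by simp), ?_, heW⟩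
      rintro (⟨-, h⟩ | ⟨-, h⟩ | ⟨h, -⟩ | ⟨h, -⟩) <;> contradiction
  have da : (arcNeighbors B a).card = 1 := by
    rw [Finset.card_eq_one]
    refine ⟨x, ?_⟩
    ext w
    simp only [mem_arcNeighbors, Finset.mem_singleton]
    constructor
    · rintro (h1 | h1)
      · exact absurd h1.1 (hak w)
      · rcases hina w h1.2.2 h1.1 with rfl | rfl
        · rfl
        · exact absurd (by simp [hH]) h1.2.1
    · rintro rfl
      refine Or.inr ⟨hxa, ?_, h.mem⟩
      rintro (⟨-, h⟩ | ⟨h, -⟩ | ⟨h, -⟩ | ⟨h, -⟩)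
      · exact hap h
      · exact hpx h.symm
      · exact hlx h.symm
      · exact hdx h.symm
  have dx : (arcNeighbors B x).card = 2 := by
    have : arcNeighbors B x = (outN O x).erase p := by
      ext w
      simp only [mem_arcNeighbors, Finset.mem_erase, mem_outN]
      constructor
      · rintro (h1 | h1)
        · exact ⟨fun e => h1.2.1 (Or.inl ⟨rfl, e⟩), h1.1⟩
        · exact absurd h1.1 (h.no_in w)
      · rintro ⟨h1, h2⟩
        refine Or.inl ⟨h2, ?_, h.mem⟩
        rintro (⟨-, h⟩ | ⟨h, -⟩ | ⟨h, -⟩ | ⟨h, -⟩)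
        · exact h1 h
        · exact hpx h.symm
        · exact hlx h.symm
        · exact hdx h.symm
    rw [this, Finset.card_erase_of_mem (by simpa), h.card_out]
  have dp : (arcNeighbors B p).card ≤ 1 := by
    refine (Finset.card_le_card (t := {s₁}) ?_).trans (by simp)
    intro w
    simp only [mem_arcNeighbors, Finset.mem_singleton]
    rintro (h1 | h1)
    · rcases (hpo w).1 h1.1 with rfl | rfl
      · exact absurd (Or.inr (Or.inl ⟨rfl, rfl⟩)) h1.2.1
      · rfl
    · have := h.unique_parent hp hxp h1.1
      exact absurd (Or.inl ⟨this, rfl⟩) h1.2.1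
  -- The sink `a` may have a third in-neighbour, outside the core, and `d` at most one parent: two
  -- obstacles in all.
  refine FourColorable.of_hole hO hG H ?_ ?_ ?_ hE hC ((inN O a \ {x, l}) ∪ inN O d) ?_ ?_
  · rintro u v (⟨rfl, rfl⟩ | ⟨rfl, rfl⟩ | ⟨rfl, rfl | rfl⟩ | ⟨rfl, rfl⟩)
    · exact ⟨hxp, h.mem⟩
    all_goals exact ⟨by assumption, by assumption⟩
  · refine (arcIrregular_spider (r := l) (a := a) (v₁ := p) (w₁ := x) (v₂ := s') (w₂ := d) ?_).congr
      ?_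
    · have : ∀ t c, t ∉ W → c ∈ W → c ≠ t := by rintro t c h1 h2 rfl; exact h1 h2
      have i1 := this a l haW hl
      have i3 := this a x haW h.mem
      have i4 := this s' x hsW' h.mem
      have i5 := this a d haW hdW
      have i6 := this s' d hsW' hdW
      simp only [List.nodup_cons, List.mem_cons, List.not_mem_nil, or_false, not_or,
        not_false_eq_true, List.nodup_nil, and_true]
      exact ⟨⟨i1, hlp, hlx, hs'l.symm, hdl.symm⟩, ⟨hap, i3.symm, has', i5.symm⟩,
        ⟨hpx, hs'p.symm, hdp.symm⟩, ⟨i4, hdx.symm⟩, i6.symm⟩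
    · clear * -
      intro u v
      simp only [Spider]
      tauto
  · intro u v huv
    have huW := huv.2.2
    change (arcNeighbors B u).card ≠ (arcNeighbors B v).card
    by_cases hux : u = x
    · subst hux
      rw [dx]
      rcases (hxo v).1 huv.1 with rfl | rfl | rfl
      · exact absurd (Or.inl ⟨rfl, rfl⟩) huv.2.1
      · rw [da]; simp
      · rw [dfull _ fb hbs']; simp
    by_cases hup : u = p
    · subst hup
      rcases (hpo v).1 huv.1 with rfl | rfl
      · exact absurd (Or.inr (Or.inl ⟨rfl, rfl⟩)) huv.2.1
      · rw [dfull _ fs₁ hs₁s']; omega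
    by_cases hul : u = l
    · subst hul
      exact absurd (Or.inr (Or.inr (Or.inl ⟨rfl, (hlo v).1 huv.1⟩))) huv.2.1
    have hu := hI u huW hux hup hul
    have hv := hu.full v huv.1
    by_cases hud : u = d
    · subst hud
      have hvs : v ≠ s' := by rintro rfl; exact huv.2.1 (by simp [hH])
      rw [dfull v hv hvs, hu.card_arcNeighbors_of_removed hBO hds]
      · simp
      · intro w
        refine ⟨fun h1 => ⟨h1.1, fun e => h1.2.1 (by simp [hH, e])⟩, fun h1 => ⟨h1.1, ?_, huW⟩⟩
        rintro (⟨h, -⟩ | ⟨h, -⟩ | ⟨h, -⟩ | ⟨-, h⟩)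
        · exact hux h
        · exact hup h
        · exact hul h
        · exact h1.2 h
    rw [hu.card_arcNeighbors hBO]
    · by_cases hvs : v = s'
      · rw [hvs, ds']; simp
      · rw [dfull v hv hvs]; simp
    · intro w hw
      refine ⟨hw, ?_, huW⟩
      rintro (⟨h, -⟩ | ⟨h, -⟩ | ⟨h, -⟩ | ⟨h, -⟩) <;> contradiction
  · have h1 := hO.degree_le d
    have h3 := hdI.card_out
    have h2 := hO.degree_le a
    have h5 : (inN O a \ {x, l}).card + ({x, l} : Finset V).card = (inN O a).card :=
      Finset.card_sdiff_add_card_eq_card (by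
        intro w hw; simp only [Finset.mem_insert, Finset.mem_singleton] at hw
        rcases hw with rfl | rfl <;> simpa)
    rw [Finset.card_pair hlx.symm] at h5
    have := Finset.card_union_le (inN O a \ {x, l}) (inN O d)
    omega
  · intro u v w huv huW hm
    have hxW := h.mem
    have hQ : O u a → u ∈ (inN O a \ {x, l}) ∪ inN O d := by
      intro hua
      refine Finset.mem_union_left _ (Finset.mem_sdiff.2 ⟨by simpa, ?_⟩)
      simp only [Finset.mem_insert, Finset.mem_singleton]
      rintro (rfl | rfl) <;> contradiction
    rcases hm with hm | hm | hm | hm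
    · exfalso
      rcases hm with ⟨rfl, -⟩ | ⟨rfl, -⟩ | ⟨rfl, -⟩ | ⟨rfl, -⟩ <;> contradiction
    · exfalso
      rcases hm with ⟨-, rfl⟩ | ⟨-, rfl⟩ | ⟨-, rfl | rfl⟩ | ⟨-, rfl⟩
      · contradiction
      · contradiction
      · exact hak _ huv
      · exact hsk' _ huv
      · exact hsk' _ huv
    · rcases hm with ⟨rfl, -⟩ | ⟨rfl, -⟩ | ⟨rfl, -⟩ | ⟨rfl, -⟩
      · exact absurd huv (h.no_in u)
      · rw [h.unique_parent hp hxp huv] at huW; contradiction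
      · rw [h.unique_parent hl hpl huv] at huW; contradiction
      · exact Finset.mem_union_right _ (by simpa)
    · rcases hm with ⟨-, rfl⟩ | ⟨-, rfl⟩ | ⟨-, rfl | rfl⟩ | ⟨-, rfl⟩
      · rw [h.unique_parent hp hxp huv] at huW; contradiction
      · rw [h.unique_parent hl hpl huv] at huW; contradiction
      · exact hQ huv
      · exact absurd (fs'.2 u huv) huW
      · exact absurd (fs'.2 u huv) huW

/-- Either all four sink heads of `x` and `l` are full, or a failing one is shared by `x` and `l`.
-/
theorem fourColorable_of_path (hG : ∀ u v, G.Adj u v ↔ O u v ∨ O v u)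
    (hE : Extends O W C) (hC : ∀ u v, O u v → u ∈ C) {p l : V} (hp : p ∈ W) (hl : l ∈ W)
    (hxp : O x p) (hpl : O p l) (hchild : ∀ y, O l y → y ∉ W) (hj : 2 ≤ sinkCount O x) :
    FourColorable G := by
  have hO := h.toSubcubicOrientation
  have hpx : p ≠ x := by rintro rfl; exact h.irrefl _ hxp
  have hlx : l ≠ x := by rintro rfl; exact h.no_in _ hpl
  obtain ⟨-, s₁, hpo, hls₁, hs₁, fs₁, -⟩ := h.structure_of_child hp hpx hl hpl
  obtain ⟨s, s', hss, hlo, hsk, hsk', hml⟩ := h.leaf_structure hl hlx hpl hchild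
  obtain ⟨a, b, hab, hap, hbp, hxo, hak, hbk, hmx⟩ := h.center_structure hp hxp hj
  have hI : ∀ c ∈ W, c ≠ x → c ≠ p → c ≠ l → IsIsolated O W c := fun c hc =>
    h.isolated_of_path hxo hpo (h.not_mem_of_sink hak) (h.not_mem_of_sink hbk) hs₁ hchild hc
  have hxa : O x a := (hxo a).2 (by simp)
  have hxb : O x b := (hxo b).2 (by simp)
  have hls : O l s := (hlo s).2 (by simp)
  have hls' : O l s' := (hlo s').2 (by simp)
  -- Isolated tails point only to full heads, and the only sink head of `p` is `s₁`, which is full.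
  have hin : ∀ t, (∀ z, ¬ O t z) → ¬ IsFull O W t → ∀ u ∈ W, O u t → u = x ∨ u = l := by
    intro t htk ht u hu hut
    by_contra! hne
    by_cases hup : u = p
    · rcases (hpo t).1 (hup ▸ hut) with rfl | rfl
      · exact htk _ hls
      · exact ht fs₁
    · exact ht ((hI u hu hne.1 hup hne.2).full t hut)
  have key : ∀ t, (t = a ∨ t = b) → (t = s ∨ t = s') → ¬ IsFull O W t → FourColorable G := by
    rintro t ht ht' hnf
    have htk : ∀ z, ¬ O t z := by rcases ht with rfl | rfl <;> assumption
    rcases ht with rfl | rfl <;> rcases ht' with rfl | rfl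
    · exact h.fourColorable_of_path_of_not_full hG hE hC hp hl hxo hpo hlo hss hab hap hbp hls₁
        hI fs₁ hnf htk (hin _ htk hnf) hmx hml
    · exact h.fourColorable_of_path_of_not_full hG hE hC hp hl hxo hpo
        (fun z => (hlo z).trans or_comm) hss.symm hab hap hbp hls₁
        hI fs₁ hnf htk (hin _ htk hnf) hmx (fun u hu => (hml u hu).imp_right Or.symm)
    · exact h.fourColorable_of_path_of_not_full hG hE hC hp hl
        (fun z => (hxo z).trans (or_congr_right or_comm)) hpo hlo hss hab.symm hbp hap hls₁
        hI fs₁ hnf htk (hin _ htk hnf) (fun u hu => (hmx u hu).imp_right Or.symm) hml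
    · exact h.fourColorable_of_path_of_not_full hG hE hC hp hl
        (fun z => (hxo z).trans (or_congr_right or_comm)) hpo
        (fun z => (hlo z).trans or_comm) hss.symm hab.symm hbp hap hls₁
        hI fs₁ hnf htk (hin _ htk hnf) (fun u hu => (hmx u hu).imp_right Or.symm)
        (fun u hu => (hml u hu).imp_right Or.symm)
  have hx4 := h.core.four_le x h.mem (by simp)
  have hl4 := h.core.four_le l hl (by simp)
  -- Somebody other than `x` must meet `x` at `t`. If `t` is not full, that is `l`, so `t` is a
  -- common head of `x` and `l`.
  have kx : ∀ t t', (t = a ∨ t = b) → (∀ z, ¬ O t z) → O x t' →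
      (∀ u ∈ meeting O W x, u = p ∨ O u t ∨ O u t') → ¬ IsFull O W t → FourColorable G := by
    intro t t' ht htk hxt' hsub hnf
    obtain ⟨u, hu, hux, hut⟩ := exists_of_meeting hO hx4 h.mem hxt' hsub
    obtain rfl := (hin t htk hnf u hu hut).resolve_left hux
    exact key t ht ((hlo t).1 hut) hnf
  have kl : ∀ t t', (t = s ∨ t = s') → (∀ z, ¬ O t z) → O l t' →
      (∀ u ∈ meeting O W l, u = p ∨ O u t ∨ O u t') → ¬ IsFull O W t → FourColorable G := by
    intro t t' ht htk hlt' hsub hnf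
    obtain ⟨u, hu, hul, hut⟩ := exists_of_meeting hO hl4 hl hlt' hsub
    obtain rfl := (hin t htk hnf u hu hut).resolve_right hul
    refine key t (((hxo t).1 hut).resolve_left ?_) ht hnf
    rintro rfl
    exact htk _ hpl
  by_cases fa : IsFull O W a
  · by_cases fb : IsFull O W b
    · by_cases fs : IsFull O W s
      · by_cases fs' : IsFull O W s'
        · exact h.fourColorable_of_path_of_full hG hE hC hp hl hxo hpo hlo hss hI fa fb fs fs' fs₁
        · exact kl s' s (Or.inr rfl) hsk' hls (fun u hu => (hml u hu).imp_right Or.symm) fs'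
      · exact kl s s' (Or.inl rfl) hsk hls' hml fs
    · exact kx b a (Or.inr rfl) hbk hxa (fun u hu => (hmx u hu).imp_right Or.symm) fb
  · exact kx a b (Or.inl rfl) hak hxb hmx fa

end IsClawCore

/-- A leaf of the core has two children that are sinks. -/
theorem IsClawCore.two_le_sinkCount {l : V} (h : IsClawCore O x W) (hl : l ∈ W) (hlx : l ≠ x) {q : V}
    (hq : O q l) (hchild : ∀ y, O l y → y ∉ W) {O' : V → V → Prop}
    (hO' : ∀ s, (∀ z, ¬ O s z) → (∀ z, ¬ O' s z) ∨ ¬ O l s) (hl' : ∀ s, O l s → O' l s) :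
    2 ≤ sinkCount O' l := by
  obtain ⟨s, s', hss, hlo, hsk, hsk', -⟩ := h.leaf_structure hl hlx hq hchild
  have hls : O l s := (hlo s).2 (by simp)
  have hls' : O l s' := (hlo s').2 (by simp)
  rw [← Finset.card_pair hss]
  refine Finset.card_le_card ?_
  intro t ht
  simp only [Finset.mem_insert, Finset.mem_singleton] at ht
  rw [Finset.mem_filter, mem_outN, outN_eq_empty]
  rcases ht with rfl | rfl
  · exact ⟨hl' _ hls, (hO' _ hsk).resolve_right (by simpa)⟩
  · exact ⟨hl' _ hls', (hO' _ hsk').resolve_right (by simpa)⟩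

/-- With at least two sink children the preceding cases apply. With fewer and a core child, the
centre is moved along core arcs to a core leaf, whose two heads are sinks. The number of sink
children then strictly grows, and `n` bounds the remaining deficit. -/
theorem FourColorable.of_claw : ∀ (n : ℕ) (O : V → V → Prop) (x : V), IsClawOrientation O x →
    (∀ u v, G.Adj u v ↔ O u v ∨ O v u) → 3 ≤ sinkCount O x + n → FourColorable G := by
  intro n
  induction n using Nat.strong_induction_on with
  | _ n ih =>
  intro O x hx hG hn
  have h2 : ∀ c ∈ ({v | (outN O v).Nonempty} : Finset V), 2 ≤ (outN O c).card := by
    intro c hc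
    have hc' : (outN O c).Nonempty := by simpa using hc
    have := Finset.card_pos.2 hc'
    by_cases hcx : c = x
    · rw [hcx, hx.card_out]; norm_num
    · have := hx.card_out_of_ne c hcx
      omega
  obtain ⟨W, -, hWC, hE, hcore⟩ := exists_core hx.toSubcubicOrientation ∅ _
    {v | (outN O v).Nonempty} le_rfl (by simp) (fun c hc _ => h2 c hc)
  have hC : ∀ u v, O u v → u ∈ ({v | (outN O v).Nonempty} : Finset V) := fun u v huv => by
    simpa using ⟨v, by simpa⟩
  by_cases hxW : x ∈ W
  · have h : IsClawCore O x W := ⟨hx, hcore, hxW, fun c hc => by simpa using hWC hc⟩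
    by_cases hch : ∃ y, O x y ∧ y ∈ W
    · obtain ⟨p, hxp, hp⟩ := hch
      have hpx : p ≠ x := by rintro rfl; exact h.irrefl _ hxp
      by_cases hj : 2 ≤ sinkCount O x
      · by_cases hch' : ∃ l, O p l ∧ l ∈ W
        · obtain ⟨l, hpl, hl⟩ := hch'
          refine h.fourColorable_of_path hG hE hC hp hl hxp hpl ?_ hj
          intro y hy hyW
          have hlx : l ≠ x := by rintro rfl; exact h.no_in _ hpl
          have := h.unique_parent hl hpl (h.structure_of_child hl hlx hyW hy).1
          exact hpx this.symm
        · push Not at hch'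
          exact h.fourColorable_of_leaf hG hE hC hp hxp hch' hj
      · have hf := hx.flipArc hxp (h.nonempty p hp)
        have hG' : ∀ u v, G.Adj u v ↔ flipArc O x p u v ∨ flipArc O x p v u := fun u v => by
          rw [flipArc_symm_closure hxp, hG]
        by_cases hch' : ∃ l, O p l ∧ l ∈ W
        · obtain ⟨l, hpl, hl⟩ := hch'
          have hlx : l ≠ x := by rintro rfl; exact h.no_in _ hpl
          have hlp : l ≠ p := by rintro rfl; exact h.irrefl _ hpl
          have hpl' : flipArc O x p p l := Or.inl ⟨hpl, fun e => hpx e.1⟩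
          have hf2 := hf.flipArc hpl' (by
            rw [outN_flipArc_of_ne hlx hlp]; exact h.nonempty l hl)
          have hchild : ∀ y, O l y → y ∉ W := by
            intro y hy hyW
            have := h.unique_parent hl hpl (h.structure_of_child hl hlx hyW hy).1
            exact hpx this.symm
          have hk := h.two_le_sinkCount hl hlx hpl hchild (O' := flipArc (flipArc O x p) p l)
            (by
              intro s hs
              by_cases hls : O l s
              · left
                have h1 : s ≠ l := by rintro rfl; exact h.irrefl _ hls
                have h2 : s ≠ p := by rintro rfl; exact hs _ hpl
                rintro z (⟨⟨h3, -⟩ | ⟨h3, -⟩, -⟩ | ⟨h3, -⟩)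
                · exact hs z h3
                · exact h2 h3
                · exact h1 h3
              · exact Or.inr hls)
            (fun s hs => Or.inl ⟨Or.inl ⟨hs, fun e => hlx e.1⟩, fun e => hlp e.1⟩)
          exact ih (n - 1) (by omega) _ l hf2
            (fun u v => by rw [flipArc_symm_closure hpl', hG']) (by omega)
        · push Not at hch'
          have hk := h.two_le_sinkCount hp hpx hxp hch' (O' := flipArc O x p)
            (by
              intro s hs
              by_cases hls : O p s
              · left
                have h1 : s ≠ p := by rintro rfl; exact h.irrefl _ hls
                rintro z (⟨h3, -⟩ | ⟨h3, -⟩)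
                · exact hs z h3
                · exact h1 h3
              · exact Or.inr hls)
            (fun s hs => Or.inl ⟨hs, fun e => hpx e.1⟩)
          exact ih (n - 1) (by omega) _ p hf hG' (by omega)
    · push Not at hch
      exact h.fourColorable_of_no_child hG hE hC hch
  · refine FourColorable.of_core_even hx.toSubcubicOrientation hG hcore ?_ hE hC
    intro c hc
    have h1 := h2 c (hWC hc)
    have hcx : c ≠ x := by rintro rfl; exact hxW hc
    have := hx.card_out_of_ne c hcx
    omega

end ClawGrandchild

/-! ### Reducing to at most one odd vertex per component -/

section Parity

open scoped Classical

variable {V : Type*} [Fintype V] {O : V → V → Prop} {G : SimpleGraph V}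

theorem FourColorable.of_flip_to_claw (hO : SubcubicOrientation O)
    (hG : ∀ u v, G.Adj u v ↔ O u v ∨ O v u) {z a v₁ w₁ v₂ w₂ : V}
    (hz : IsSpiderCenter O z a v₁ w₁ v₂ w₂)
    (h : ∀ v, v ≠ z → (outN O v).card = 0 ∨ (outN O v).card = 2)
    (hw₁ : (outN O w₁).Nonempty) : FourColorable G := by
  obtain ⟨hza, hv₁, hv₂, hv, hw, haw₁, haw₂, hzw₁, hzw₂⟩ := hz
  have z1 : O v₁ z := (hv₁ z).2 (Or.inl rfl)
  have w1 : O v₁ w₁ := (hv₁ w₁).2 (Or.inr rfl)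
  have hv₁z : v₁ ≠ z := by rintro rfl; exact hO.irrefl _ z1
  have hv₁w : v₁ ≠ w₁ := by rintro rfl; exact hO.irrefl _ w1
  have w1' : flipArc O v₁ z v₁ w₁ := Or.inl ⟨w1, fun e => hzw₁ e.2.symm⟩
  have hO₁ := hO.flipArc z1
  have cw : (outN O w₁).card = 2 := by
    have := Finset.card_pos.2 hw₁
    have := h w₁ hzw₁.symm
    omega
  -- Reversing both arcs out of `v₁` changes out-degrees to 0 at `v₁`, 2 at `z` and 3 at `w₁`. The
  -- value 3 makes the requirement on sinks vacuous.
  refine FourColorable.of_claw 3 (flipArc (flipArc O v₁ z) v₁ w₁) w₁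
    ⟨hO₁.flipArc w1', ?_, ?_⟩ ?_ (by omega)
  · rw [outN_flipArc_head hv₁w, Finset.card_insert_of_notMem
      (by simpa using hO₁.asymm _ _ w1'), outN_flipArc_of_ne hv₁w.symm hzw₁.symm, cw]
  · intro v hvw
    by_cases hvv : v = v₁
    · subst hvv
      rw [outN_flipArc_tail hvw, outN_flipArc_tail hv₁z]
      left
      rw [Finset.card_eq_zero, Finset.eq_empty_iff_forall_notMem]
      intro u hu
      simp only [Finset.mem_erase, mem_outN] at hu
      rcases (hv₁ u).1 hu.2.2 with h1 | h1
      · exact hu.2.1 h1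
      · exact hu.1 h1
    · rw [outN_flipArc_of_ne hvv hvw]
      by_cases hvz : v = z
      · subst hvz
        rw [outN_flipArc_head (Ne.symm hvv), Finset.card_insert_of_notMem
          (by simpa using hO.asymm _ _ z1)]
        have : outN O v = {a} := by ext u; simp [hza]
        rw [this]; simp
      · rw [outN_flipArc_of_ne hvv hvz]
        exact h v hvz
  · intro u v
    rw [flipArc_symm_closure w1', flipArc_symm_closure z1, hG]

theorem FourColorable.of_spiderCenter (hO : SubcubicOrientation O)
    (hG : ∀ u v, G.Adj u v ↔ O u v ∨ O v u) {z a v₁ w₁ v₂ w₂ : V}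
    (hz : IsSpiderCenter O z a v₁ w₁ v₂ w₂)
    (h : ∀ v, v ≠ z → (outN O v).card = 0 ∨ (outN O v).card = 2) : FourColorable G := by
  by_cases hw₁ : (outN O w₁).Nonempty
  · exact FourColorable.of_flip_to_claw hO hG hz h hw₁
  by_cases hw₂ : (outN O w₂).Nonempty
  · obtain ⟨hza, hv₁, hv₂, hv, hw, haw₁, haw₂, hzw₁, hzw₂⟩ := hz
    exact FourColorable.of_flip_to_claw hO hG (a := a) (v₁ := v₂) (v₂ := v₁) (w₂ := w₁)
      ⟨hza, hv₂, hv₁, hv.symm, hw.symm, haw₂, haw₁, hzw₂, hzw₁⟩ h hw₂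
  by_cases ha : (outN O a).Nonempty
  · have za : O z a := (hz.1 a).2 rfl
    have hne : z ≠ a := by rintro rfl; exact hO.irrefl _ za
    have ca : (outN O a).card = 2 := by
      have := Finset.card_pos.2 ha
      have := h a hne.symm
      omega
    refine FourColorable.of_claw 3 (flipArc O z a) a ⟨hO.flipArc za, ?_, ?_⟩ ?_ (by omega)
    · rw [outN_flipArc_head hne, Finset.card_insert_of_notMem (by simpa using hO.asymm _ _ za), ca]
    · intro v hva
      by_cases hvz : v = z
      · subst hvz
        have : outN O v = {a} := by ext u; simp [hz.1]
        rw [outN_flipArc_tail hne, this]; simp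
      · rw [outN_flipArc_of_ne hvz hva]
        exact h v hvz
    · intro u v
      rw [flipArc_symm_closure za, hG]
  rw [Finset.not_nonempty_iff_eq_empty, outN_eq_empty] at hw₁ hw₂ ha
  exact FourColorable.of_spiderCenter_of_sinks hO hG hz h ha hw₁ hw₂

/-- `z` has out-degree three or is the centre of a spider. -/
def IsGoodCenter (O : V → V → Prop) (z : V) : Prop :=
  (outN O z).card = 3 ∨ ∃ a v₁ w₁ v₂ w₂, IsSpiderCenter O z a v₁ w₁ v₂ w₂

theorem SubcubicOrientation.card_out_of_not_odd (hO : SubcubicOrientation O) {v : V}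
    (h : ¬ Odd (outN O v).card) : (outN O v).card = 0 ∨ (outN O v).card = 2 := by
  have := hO.degree_le v
  have h3 : (outN O v).card ≤ 3 := by omega
  generalize (outN O v).card = m at h h3
  interval_cases m <;> simp_all (decide := true)

theorem FourColorable.of_unique_odd (hO : SubcubicOrientation O)
    (hG : ∀ u v, G.Adj u v ↔ O u v ∨ O v u)
    (hgood : ∀ v, Odd (outN O v).card → IsGoodCenter O v)
    (huniq : ∀ u v, Odd (outN O u).card → Odd (outN O v).card → u = v) : FourColorable G := by
  by_cases hx : ∃ x, Odd (outN O x).card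
  · obtain ⟨x, hx⟩ := hx
    have h : ∀ v, v ≠ x → (outN O v).card = 0 ∨ (outN O v).card = 2 := fun v hv =>
      hO.card_out_of_not_odd (fun h => hv (huniq v x h hx))
    rcases hgood x hx with h3 | ⟨a, v₁, w₁, v₂, w₂, hs⟩
    · exact FourColorable.of_claw 3 O x ⟨hO, h3, h⟩ hG (by omega)
    · exact FourColorable.of_spiderCenter hO hG hs h
  · push Not at hx
    exact FourColorable.of_even hO hG (fun v => hO.card_out_of_not_odd (hx v))

/-- The condition `w = u ↔ w = v` fails exactly at the two ends, where parity toggles. In this form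
the toggles telescope along a walk. -/
theorem exists_flip_edge (hO : SubcubicOrientation O) (hG : ∀ u v, G.Adj u v ↔ O u v ∨ O v u)
    {u v : V} (huv : G.Adj u v) : ∃ O' : V → V → Prop, SubcubicOrientation O' ∧
      (∀ u v, G.Adj u v ↔ O' u v ∨ O' v u) ∧
      (∀ a b, ¬ ((a = u ∨ a = v) ∧ (b = u ∨ b = v)) → (O' a b ↔ O a b)) ∧
      ∀ w, (Odd (outN O' w).card ↔ (Odd (outN O w).card ↔ (w = u ↔ w = v))) := by
  have key : ∀ u v, O u v → SubcubicOrientation (flipArc O u v) ∧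
      (∀ a b, G.Adj a b ↔ flipArc O u v a b ∨ flipArc O u v b a) ∧
      (∀ a b, ¬ ((a = u ∨ a = v) ∧ (b = u ∨ b = v)) → (flipArc O u v a b ↔ O a b)) ∧
      ∀ w, (Odd (outN (flipArc O u v) w).card ↔ (Odd (outN O w).card ↔ (w = u ↔ w = v))) := by
    intro u v h
    have hne : u ≠ v := by rintro rfl; exact hO.irrefl _ h
    refine ⟨hO.flipArc h, fun a b => by rw [flipArc_symm_closure h, hG], ?_, ?_⟩
    · intro a b hab
      unfold flipArc
      tauto
    · intro w
      by_cases hwu : w = u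
      · subst hwu
        have h1 : 0 < (outN O w).card := Finset.card_pos.2 ⟨v, by simpa⟩
        rw [outN_flipArc_tail hne, Finset.card_erase_of_mem (by simpa)]
        obtain ⟨m, hm⟩ : ∃ m, (outN O w).card = m + 1 := ⟨_, (Nat.succ_pred_eq_of_pos h1).symm⟩
        simp [hm, hne, Nat.odd_add_one]
      · by_cases hwv : w = v
        · subst hwv
          rw [outN_flipArc_head hne, Finset.card_insert_of_notMem (by simpa using hO.asymm _ _ h)]
          simp [hwu, Nat.odd_add_one]
        · rw [outN_flipArc_of_ne hwu hwv]
          simp [hwu, hwv]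
  rcases (hG u v).1 huv with h | h
  · exact ⟨_, key u v h⟩
  · obtain ⟨h1, h2, h3, h4⟩ := key v u h
    exact ⟨_, h1, h2, fun a b hab => h3 a b (by tauto), fun w => by rw [h4 w]; tauto⟩

theorem exists_flip_walk {u v : V} (p : G.Walk u v) : ∀ (O : V → V → Prop),
    SubcubicOrientation O → (∀ u v, G.Adj u v ↔ O u v ∨ O v u) →
    ∃ O' : V → V → Prop, SubcubicOrientation O' ∧ (∀ u v, G.Adj u v ↔ O' u v ∨ O' v u) ∧
      (∀ a b, ¬ (a ∈ p.support ∧ b ∈ p.support) → (O' a b ↔ O a b)) ∧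
      ∀ w, (Odd (outN O' w).card ↔ (Odd (outN O w).card ↔ (w = u ↔ w = v))) := by
  induction p with
  | nil =>
    intro O hO hG
    exact ⟨O, hO, hG, fun _ _ _ => Iff.rfl, fun w => by simp⟩
  | @cons u v w h p ih =>
    intro O hO hG
    obtain ⟨O₁, a1, a2, a3, a4⟩ := exists_flip_edge hO hG h
    obtain ⟨O₂, b1, b2, b3, b4⟩ := ih O₁ a1 a2
    refine ⟨O₂, b1, b2, ?_, ?_⟩
    · intro a b hab
      simp only [SimpleGraph.Walk.support_cons, List.mem_cons] at hab
      have hv := p.start_mem_support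
      rw [b3 a b (by tauto), a3 a b ?_]
      rintro ⟨h1 | h1, h2 | h2⟩ <;> subst h1 h2 <;> tauto
    · intro t
      rw [b4 t, a4 t]
      tauto

/-- An orientation of `G` all of whose vertices of odd out-degree are good centres. -/
structure IsGoodOrientation (G : SimpleGraph V) (O : V → V → Prop) : Prop
    extends SubcubicOrientation O where
  adj_iff : ∀ u v, G.Adj u v ↔ O u v ∨ O v u
  good : ∀ v, Odd (outN O v).card → IsGoodCenter O v

/-- The vertices of odd out-degree. -/
noncomputable def oddOut (O : V → V → Prop) : Finset V := {v | Odd (outN O v).card}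

@[simp] theorem mem_oddOut {v : V} : v ∈ oddOut O ↔ Odd (outN O v).card := by simp [oddOut]

/-- The condition on the walk keeps every other odd `z`, and the tails `v₁`, `v₂` of its spider, off
the walk. Their out-neighbourhoods, which certify that `z` is good, are thus unchanged. -/
theorem IsGoodOrientation.exists_reduction (h : IsGoodOrientation G O) {x y : V}
    (hx : Odd (outN O x).card) (hy : Odd (outN O y).card) (hxy : x ≠ y) (p : G.Walk x y)
    (hp : ∀ z, Odd (outN O z).card → z ≠ x → z ≠ y →
      z ∉ p.support ∧ ∀ v ∈ p.support, (outN O v).card = 2 → ¬ O v z) :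
    ∃ O', IsGoodOrientation G O' ∧ (oddOut O').card < (oddOut O).card := by
  obtain ⟨O', h1, h2, h3, h4⟩ := exists_flip_walk p O h.toSubcubicOrientation h.adj_iff
  have hodd : ∀ w, Odd (outN O' w).card ↔ Odd (outN O w).card ∧ w ≠ x ∧ w ≠ y := by
    intro w
    rw [h4 w]
    by_cases hwx : w = x
    · subst hwx; simp [hx, hxy]
    · by_cases hwy : w = y
      · subst hwy; simp [hy, hwx]
      · simp [hwx, hwy]
  refine ⟨O', ⟨h1, h2, ?_⟩, ?_⟩
  · intro z hz
    obtain ⟨hz, hzx, hzy⟩ := (hodd z).1 hz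
    obtain ⟨hzp, hin⟩ := hp z hz hzx hzy
    rcases h.good z hz with hg | ⟨a, v₁, w₁, v₂, w₂, hza, hv₁, hv₂, hv, hw, haw₁, haw₂, hzw₁, hzw₂⟩
    · left
      rw [← hg]
      congr 1; ext w
      simp only [mem_outN]
      exact h3 z w (fun e => hzp e.1)
    · have e1 : outN O v₁ = {z, w₁} := by ext u; simp [hv₁]
      have e2 : outN O v₂ = {z, w₂} := by ext u; simp [hv₂]
      have n1 : v₁ ∉ p.support := fun hv =>
        hin v₁ hv (by rw [e1, Finset.card_pair hzw₁]) ((hv₁ z).2 (Or.inl rfl))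
      have n2 : v₂ ∉ p.support := fun hv =>
        hin v₂ hv (by rw [e2, Finset.card_pair hzw₂]) ((hv₂ z).2 (Or.inl rfl))
      exact Or.inr ⟨a, v₁, w₁, v₂, w₂, fun u => by rw [h3 z u (fun e => hzp e.1), hza],
        fun u => by rw [h3 v₁ u (fun e => n1 e.1), hv₁],
        fun u => by rw [h3 v₂ u (fun e => n2 e.1), hv₂], hv, hw, haw₁, haw₂, hzw₁, hzw₂⟩
  · refine Finset.card_lt_card ((Finset.ssubset_iff_of_subset ?_).2 ⟨x, ?_, ?_⟩)
    · intro w hw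
      simp only [mem_oddOut] at hw ⊢
      exact ((hodd w).1 hw).1
    · simpa
    · simp [hodd]

theorem IsGoodOrientation.exists_reduction_of_common_parent (h : IsGoodOrientation G O)
    {v x y : V} (hx : Odd (outN O x).card) (hy : Odd (outN O y).card) (hxy : x ≠ y)
    (hv : (outN O v).card = 2) (hvx : O v x) (hvy : O v y) :
    ∃ O', IsGoodOrientation G O' ∧ (oddOut O').card < (oddOut O).card := by
  have a1 : G.Adj x v := (h.adj_iff _ _).2 (Or.inr hvx)
  have a2 : G.Adj v y := (h.adj_iff _ _).2 (Or.inl hvy)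
  have ho : ∀ z, O v z → z = x ∨ z = y := by
    have : {x, y} = outN O v := by
      refine Finset.eq_of_subset_of_card_le ?_ (by rw [Finset.card_pair hxy, hv])
      intro u hu; simp at hu; rcases hu with rfl | rfl <;> simpa
    intro z hz
    have : z ∈ ({x, y} : Finset V) := by rw [this]; simpa
    simpa using this
  have hve : ¬ Odd (outN O v).card := by rw [hv]; decide
  refine h.exists_reduction hx hy hxy (.cons a1 (.cons a2 .nil)) ?_
  intro z hz hzx hzy
  simp only [SimpleGraph.Walk.support_cons, SimpleGraph.Walk.support_nil, List.mem_cons,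
    List.not_mem_nil, or_false]
  refine ⟨?_, ?_⟩
  · rintro (rfl | rfl | rfl) <;> contradiction
  · rintro u (rfl | rfl | rfl) hu huz
    · rw [hu] at hx; exact absurd hx (by decide)
    · rcases ho z huz with rfl | rfl <;> contradiction
    · rw [hu] at hy; exact absurd hy (by decide)

/-- Take a shortest walk among all pairs of distinct odd vertices. It avoids other odd vertices; if
some `v` on it of out-degree 2 points to an odd `z` off its ends, the walk through `v` is replaced
by one joining the two out-neighbours of `v`. -/
theorem IsGoodOrientation.exists_reduction_of_reachable (h : IsGoodOrientation G O)
    {x y : V} (hx : Odd (outN O x).card) (hy : Odd (outN O y).card) (hxy : x ≠ y)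
    (hr : G.Reachable x y) :
    ∃ O', IsGoodOrientation G O' ∧ (oddOut O').card < (oddOut O).card := by
  have hex : ∃ n : ℕ, ∃ x y, Odd (outN O x).card ∧ Odd (outN O y).card ∧ x ≠ y ∧
      ∃ p : G.Walk x y, p.length = n := by
    obtain ⟨p⟩ := hr
    exact ⟨p.length, x, y, hx, hy, hxy, p, rfl⟩
  clear hx hy hxy hr x y
  obtain ⟨x, y, hx, hy, hxy, p, hp⟩ := Nat.find_spec hex
  have hmin : ∀ x y, Odd (outN O x).card → Odd (outN O y).card → x ≠ y →
      ∀ q : G.Walk x y, p.length ≤ q.length := by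
    intro x y hx hy hxy q
    rw [hp]
    exact Nat.find_min' hex ⟨x, y, hx, hy, hxy, q, rfl⟩
  clear hp hex
  by_cases hc : ∃ z v, Odd (outN O z).card ∧ z ≠ x ∧ z ≠ y ∧ v ∈ p.support ∧
      (outN O v).card = 2 ∧ O v z
  · obtain ⟨z, v, hz, hzx, hzy, hvp, hv2, hvz⟩ := hc
    have hve : ¬ Odd (outN O v).card := by rw [hv2]; decide
    have hvx : v ≠ x := by rintro rfl; exact hve hx
    have hvy : v ≠ y := by rintro rfl; exact hve hy
    have hadj : G.Adj v z := (h.adj_iff _ _).2 (Or.inl hvz)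
    have l1 := hmin x z hx hz hzx.symm ((p.takeUntil v hvp).concat hadj)
    have l2 := hmin z y hz hy hzy (.cons hadj.symm (p.dropUntil v hvp))
    have l3 := congrArg SimpleGraph.Walk.length (p.take_spec hvp)
    have l4 : (p.takeUntil v hvp).length ≠ 0 := fun e =>
      hvx (SimpleGraph.Walk.eq_of_length_eq_zero e).symm
    have l5 : (p.dropUntil v hvp).length ≠ 0 := fun e =>
      hvy (SimpleGraph.Walk.eq_of_length_eq_zero e)
    rw [SimpleGraph.Walk.length_concat] at l1
    rw [SimpleGraph.Walk.length_cons] at l2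
    rw [SimpleGraph.Walk.length_append] at l3
    -- Replacing either part of the walk by the edge `vz` cannot shorten it, so both parts have
    -- length 1. Then `x`, `y`, `z` are all the neighbours of `v`, and its second out-neighbour is
    -- odd too.
    have b1 := SimpleGraph.Walk.adj_of_length_eq_one
      (show (p.takeUntil v hvp).length = 1 by omega)
    have b2 := SimpleGraph.Walk.adj_of_length_eq_one
      (show (p.dropUntil v hvp).length = 1 by omega)
    obtain ⟨w, hzw, hvo⟩ := exists_other_of_card_two hv2 hvz
    have hvw : O v w := (hvo w).2 (Or.inr rfl)
    have hnb : {x, y, z} = outN O v ∪ inN O v := by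
      refine Finset.eq_of_subset_of_card_le ?_ ?_
      · intro u hu
        simp only [Finset.mem_insert, Finset.mem_singleton] at hu
        simp only [Finset.mem_union, mem_outN, mem_inN, ← h.adj_iff]
        rcases hu with rfl | rfl | rfl
        · exact b1.symm
        · exact b2
        · exact hadj
      · rw [Finset.card_eq_three.2 ⟨x, y, z, hxy, hzx.symm, hzy.symm, rfl⟩]
        exact (Finset.card_union_le _ _).trans (h.degree_le v)
    have hw : w ∈ ({x, y, z} : Finset V) := by rw [hnb]; simp [hvw]
    have hwo : Odd (outN O w).card := by
      simp only [Finset.mem_insert, Finset.mem_singleton] at hw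
      rcases hw with rfl | rfl | rfl <;> assumption
    exact h.exists_reduction_of_common_parent hz hwo hzw hv2 hvz hvw
  · push Not at hc
    refine h.exists_reduction hx hy hxy p ?_
    intro z hz hzx hzy
    refine ⟨?_, fun v hv hv2 => hc z v hz hzx hzy hv hv2⟩
    intro hzp
    have l1 := hmin x z hx hz hzx.symm (p.takeUntil z hzp)
    have l3 := congrArg SimpleGraph.Walk.length (p.take_spec hzp)
    have l5 : (p.dropUntil z hzp).length ≠ 0 := fun e =>
      hzy (SimpleGraph.Walk.eq_of_length_eq_zero e)
    rw [SimpleGraph.Walk.length_append] at l3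
    omega

theorem IsGoodOrientation.exists_separated : ∀ (n : ℕ) (O : V → V → Prop),
    IsGoodOrientation G O → (oddOut O).card ≤ n → ∃ O', IsGoodOrientation G O' ∧
      ∀ x y, Odd (outN O' x).card → Odd (outN O' y).card → G.Reachable x y → x = y := by
  intro n
  induction n with
  | zero =>
    intro O h hn
    refine ⟨O, h, fun x y hx => ?_⟩
    have : x ∈ oddOut O := by simpa
    rw [Finset.card_eq_zero.1 (Nat.le_zero.1 hn)] at this
    simp at this
  | succ n ih =>
    intro O h hn
    by_cases hc : ∃ x y, Odd (outN O x).card ∧ Odd (outN O y).card ∧ x ≠ y ∧ G.Reachable x y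
    · obtain ⟨x, y, hx, hy, hxy, hr⟩ := hc
      obtain ⟨O', h', hlt⟩ := h.exists_reduction_of_reachable hx hy hxy hr
      exact ih O' h' (by omega)
    · push Not at hc
      refine ⟨O, h, fun x y hx hy hr => ?_⟩
      by_contra hne
      exact hc x y hx hy hne hr

/-- Each component has at most one odd vertex and is coloured separately. Adjacent vertices lie in
one component, so the colourings glue without changing degrees. -/
theorem IsGoodOrientation.fourColorable (h : IsGoodOrientation G O)
    (hsep : ∀ x y, Odd (outN O x).card → Odd (outN O y).card → G.Reachable x y → x = y) :
    FourColorable G := by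
  have key : ∀ K : G.ConnectedComponent, ∃ f : V → V → Fin 4,
      (∀ u v, G.Adj u v → G.connectedComponentMk u = K → f u v = f v u) ∧ ∀ k,
        ArcIrregular (fun u v => (G.Adj u v ∧ G.connectedComponentMk u = K) ∧ f u v = k) := by
    intro K
    have hcomp : ∀ u v, O u v → G.connectedComponentMk u = G.connectedComponentMk v := fun u v huv =>
      SimpleGraph.ConnectedComponent.sound ((h.adj_iff u v).2 (Or.inl huv)).reachable
    have hadj : ∀ u v, G.Adj u v → G.connectedComponentMk u = G.connectedComponentMk v :=
      fun u v huv => SimpleGraph.ConnectedComponent.sound huv.reachable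
    set OK : V → V → Prop := fun u v => O u v ∧ G.connectedComponentMk u = K with hOK
    have hout : ∀ v, G.connectedComponentMk v = K → outN OK v = outN O v := by
      intro v hv; ext w; simp [hOK, hv]
    have hout' : ∀ v, Odd (outN OK v).card → G.connectedComponentMk v = K := by
      intro v hv
      by_contra hvK
      have : outN OK v = ∅ := outN_eq_empty.2 (fun w hw => hvK hw.2)
      simp [this] at hv
    set GK : SimpleGraph V :=
      { Adj := fun u v => G.Adj u v ∧ G.connectedComponentMk u = K
        symm := ⟨fun u v huv => ⟨huv.1.symm, by rw [← hadj u v huv.1]; exact huv.2⟩⟩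
        loopless := ⟨fun v hv => G.loopless.irrefl v hv.1⟩ } with hGK
    have hc : FourColorable GK := by
      refine FourColorable.of_unique_odd (O := OK) ⟨?_, ?_⟩ ?_ ?_ ?_
      · exact fun u v huv hvu => h.asymm u v huv.1 hvu.1
      · intro v
        refine (Nat.add_le_add (Finset.card_le_card ?_) (Finset.card_le_card ?_)).trans
          (h.degree_le v)
        · intro w hw; simp only [mem_outN] at hw ⊢; exact hw.1
        · intro w hw; simp only [mem_inN] at hw ⊢; exact hw.1
      · intro u v
        have h1 := hcomp v u
        change (G.Adj u v ∧ _) ↔ _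
        rw [h.adj_iff]
        constructor
        · rintro ⟨huv | huv, hu⟩
          · exact Or.inl ⟨huv, hu⟩
          · exact Or.inr ⟨huv, (h1 huv).trans hu⟩
        · rintro (⟨huv, hu⟩ | ⟨huv, hu⟩)
          · exact ⟨Or.inl huv, hu⟩
          · exact ⟨Or.inr huv, (h1 huv).symm.trans hu⟩
      · intro v hv
        have hvK := hout' v hv
        rw [hout v hvK] at hv
        rcases h.good v hv with hg | ⟨a, v₁, w₁, v₂, w₂, hza, hv₁, hv₂, hr⟩
        · exact Or.inl (by rw [hout v hvK, hg])
        · have c1 : G.connectedComponentMk v₁ = K :=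
            (hcomp _ _ ((hv₁ v).2 (Or.inl rfl))).trans hvK
          have c2 : G.connectedComponentMk v₂ = K :=
            (hcomp _ _ ((hv₂ v).2 (Or.inl rfl))).trans hvK
          exact Or.inr ⟨a, v₁, w₁, v₂, w₂, fun u => by simp [hOK, hza, hvK],
            fun u => by simp [hOK, hv₁, c1], fun u => by simp [hOK, hv₂, c2], hr⟩
      · intro u v hu hv
        have hu' := hout' u hu
        have hv' := hout' v hv
        rw [hout u hu'] at hu
        rw [hout v hv'] at hv
        exact hsep u v hu hv (SimpleGraph.ConnectedComponent.exact (hu'.trans hv'.symm))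
    obtain ⟨f, hf1, hf2⟩ := hc
    exact ⟨f, fun u v h1 h2 => hf1 u v ⟨h1, h2⟩, hf2⟩
  choose f hf1 hf2 using key
  have hadj : ∀ u v, G.Adj u v → G.connectedComponentMk u = G.connectedComponentMk v :=
    fun u v huv => SimpleGraph.ConnectedComponent.sound huv.reachable
  refine ⟨fun u v => f (G.connectedComponentMk u) u v, ?_, ?_⟩
  · intro u v huv
    change f (G.connectedComponentMk u) u v = f (G.connectedComponentMk v) v u
    rw [← hadj u v huv]
    exact hf1 _ u v huv rfl
  · intro k
    have e : ∀ K v, G.connectedComponentMk v = K →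
        arcNeighbors (fun u v => G.Adj u v ∧ f (G.connectedComponentMk u) u v = k) v =
        arcNeighbors (fun u v => (G.Adj u v ∧ G.connectedComponentMk u = K) ∧ f K u v = k) v := by
      rintro K v rfl
      ext w
      simp only [mem_arcNeighbors]
      refine or_congr ?_ ?_
      · simp
      · constructor
        · rintro ⟨h1, h2⟩
          have := hadj w v h1
          exact ⟨⟨h1, this⟩, by rw [← this]; exact h2⟩
        · rintro ⟨⟨h1, h2⟩, h3⟩
          exact ⟨h1, by rw [h2]; exact h3⟩
    intro u v huv
    rw [e _ u rfl, e _ v (hadj u v huv.1).symm]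
    exact hf2 _ k ⟨⟨huv.1, rfl⟩, huv.2⟩

end Parity

/-! ### From a locally irregular decomposition to a good orientation -/

section Initial

open scoped Classical

variable {V : Type*} [Fintype V] {G : SimpleGraph V}

theorem card_outN_adj (L : SimpleGraph V) [DecidableRel L.Adj] (v : V) :
    (outN L.Adj v).card = L.degree v := by
  rw [← SimpleGraph.card_neighborFinset_eq_degree]
  congr 1; ext w; simp

theorem SimpleGraph.IsLocallyIrregular.card_outN_ne {L : SimpleGraph V} (hL : L.IsLocallyIrregular)
    {u v : V} (h : L.Adj u v) : (outN L.Adj u).card ≠ (outN L.Adj v).card := by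
  rw [card_outN_adj, card_outN_adj]; exact hL h

/-- `u` has degree two in `L` and a neighbour of degree one. -/
def IsLeafy (L : SimpleGraph V) (u : V) : Prop :=
  (outN L.Adj u).card = 2 ∧ ∃ w, L.Adj u w ∧ (outN L.Adj w).card = 1

/-- The edge `uv` of the locally irregular subcubic graph `L` is directed from `u` to `v`. -/
def IsIrregularArc (L : SimpleGraph V) (u v : V) : Prop :=
  L.Adj u v ∧ (IsLeafy L u ∨ ((outN L.Adj u).card = 3 ∧ ¬ IsLeafy L v))

theorem IsIrregularArc.asymm {L : SimpleGraph V} (hL : L.IsLocallyIrregular) {u v : V}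
    (h : IsIrregularArc L u v) : ¬ IsIrregularArc L v u := by
  intro h'
  have hne : (outN L.Adj u).card ≠ (outN L.Adj v).card := hL.card_outN_ne h.1
  rcases h.2 with h1 | h1 <;> rcases h'.2 with h2 | h2
  · exact hne (h1.1.trans h2.1.symm)
  · exact h2.2 h1
  · exact h1.2 h2
  · exact hne (h1.1.trans h2.1.symm)

theorem isIrregularArc_or {L : SimpleGraph V} (hL : L.IsLocallyIrregular)
    (h3 : ∀ v, (outN L.Adj v).card ≤ 3) {u v : V} (h : L.Adj u v) :
    IsIrregularArc L u v ∨ IsIrregularArc L v u := by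
  have hne : (outN L.Adj u).card ≠ (outN L.Adj v).card := hL.card_outN_ne h
  have hu : 0 < (outN L.Adj u).card := Finset.card_pos.2 ⟨v, by simpa⟩
  have hv : 0 < (outN L.Adj v).card := Finset.card_pos.2 ⟨u, by simpa using h.symm⟩
  have key : ∀ u v, L.Adj u v → (outN L.Adj u).card < (outN L.Adj v).card → 0 < (outN L.Adj u).card →
      IsIrregularArc L u v ∨ IsIrregularArc L v u := by
    intro u v h hlt hu
    have := h3 v
    by_cases hl : IsLeafy L u
    · exact Or.inl ⟨h, Or.inl hl⟩
    · by_cases hv : (outN L.Adj v).card = 3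
      · exact Or.inr ⟨h.symm, Or.inr ⟨hv, hl⟩⟩
      · exact Or.inr ⟨h.symm, Or.inl ⟨by omega, u, h.symm, by omega⟩⟩
  rcases lt_or_gt_of_ne hne with hlt | hlt
  · exact key u v h hlt hu
  · exact (key v u h.symm hlt hv).symm

/-- Within a colour class, leafy vertices send out both edges, and a vertex of degree 3 sends out
all edges except those to leafy neighbours. All others send out none. So an odd out-degree is 3, or
it is 1 with two leafy neighbours, whose leaves complete a spider. -/
theorem exists_goodOrientation (h3 : ∀ v, (outN G.Adj v).card ≤ 3) {K : Type*} (c : G.EdgeLabeling K)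
    (hc : c.IsLocallyIrregular) : ∃ O, IsGoodOrientation G O := by
  have hsub : ∀ k v, (outN (c.labelGraph k).Adj v).card ≤ (outN G.Adj v).card := by
    intro k v
    refine Finset.card_le_card ?_
    intro w hw
    simp only [mem_outN] at hw ⊢
    exact c.labelGraph_le hw
  have huniq : ∀ k k' u v, (c.labelGraph k).Adj u v → (c.labelGraph k').Adj u v → k = k' := by
    intro k k' u v h h'
    rw [SimpleGraph.EdgeLabeling.labelGraph_adj] at h h'
    obtain ⟨H, rfl⟩ := h
    obtain ⟨H', rfl⟩ := h'
    rfl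
  have hother : ∀ k k' v, k ≠ k' → (outN (c.labelGraph k).Adj v).card + (outN (c.labelGraph k').Adj v).card ≤ 3 := by
    intro k k' v hk
    refine le_trans ?_ (h3 v)
    rw [← Finset.card_union_of_disjoint]
    · refine Finset.card_le_card ?_
      intro w hw
      simp only [Finset.mem_union, mem_outN] at hw ⊢
      rcases hw with hw | hw <;> exact c.labelGraph_le hw
    · rw [Finset.disjoint_left]
      intro w hw hw'
      simp only [mem_outN] at hw hw'
      exact hk (huniq _ _ _ _ hw hw')
  set O : V → V → Prop := fun u v => ∃ k, IsIrregularArc (c.labelGraph k) u v with hO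
  have hadj : ∀ u v, G.Adj u v ↔ O u v ∨ O v u := by
    intro u v
    constructor
    · intro h
      have hk : (c.labelGraph (c ⟨s(u, v), h⟩)).Adj u v := by
        rw [SimpleGraph.EdgeLabeling.labelGraph_adj]; exact ⟨h, rfl⟩
      exact (isIrregularArc_or (hc _) (fun v => (hsub _ v).trans (h3 v)) hk).imp
        (fun h => ⟨_, h⟩) (fun h => ⟨_, h⟩)
    · rintro (⟨k, h⟩ | ⟨k, h⟩)
      · exact c.labelGraph_le h.1
      · exact (c.labelGraph_le h.1).symm
  have hasymm : ∀ u v, O u v → ¬ O v u := by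
    rintro u v ⟨k, h⟩ ⟨k', h'⟩
    obtain rfl := huniq _ _ _ _ h.1 h'.1.symm
    exact h.asymm (hc k) h'
  -- An arc leaves `v` only in a colour where `v` has degree at least 2, and by `hother` there is at
  -- most one such colour.
  have hout : ∀ k v, 2 ≤ (outN (c.labelGraph k).Adj v).card →
      ∀ w, O v w ↔ IsIrregularArc (c.labelGraph k) v w := by
    intro k v hv w
    refine ⟨?_, fun h => ⟨k, h⟩⟩
    rintro ⟨k', h⟩
    by_cases hk : k = k'
    · rwa [hk]
    · have h1 := hother k k' v hk
      have h2 : 2 ≤ (outN (c.labelGraph k').Adj v).card := by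
        rcases h.2 with h | h
        · exact h.1.ge
        · omega
      omega
  have hleafy : ∀ k v, IsLeafy (c.labelGraph k) v → ∀ w, O v w ↔ (c.labelGraph k).Adj v w := by
    intro k v hv w
    rw [hout k v hv.1.ge]
    exact ⟨fun h => h.1, fun h => ⟨h, Or.inl hv⟩⟩
  refine ⟨O, ⟨hasymm, ?_⟩, hadj, ?_⟩
  · intro v
    refine le_trans ?_ (h3 v)
    rw [← Finset.card_union_of_disjoint]
    · refine Finset.card_le_card ?_
      intro w hw
      simp only [Finset.mem_union, mem_outN, mem_inN] at hw
      rw [mem_outN, hadj]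
      exact hw
    · rw [Finset.disjoint_left]
      intro w hw hw'
      simp only [mem_outN, mem_inN] at hw hw'
      exact hasymm _ _ hw hw'
  · intro v hv
    obtain ⟨w, hw⟩ := Finset.card_pos.1 hv.pos
    obtain ⟨k, hk⟩ := mem_outN.1 hw
    rcases hk.2 with hl | ⟨hd, -⟩
    · exfalso
      have : outN O v = outN (c.labelGraph k).Adj v := by
        ext u; rw [mem_outN, hleafy k v hl, mem_outN]
      rw [this, hl.1] at hv
      exact absurd hv (by decide)
    · set L := c.labelGraph k with hL
      have e1 : outN O v = (outN L.Adj v).filter (fun u => ¬ IsLeafy L u) := by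
        ext u
        rw [mem_outN, hout k v (show 2 ≤ (outN L.Adj v).card by omega), Finset.mem_filter, mem_outN]
        refine ⟨fun h => ⟨h.1, ?_⟩, fun h => ⟨h.1, Or.inr ⟨hd, h.2⟩⟩⟩
        rcases h.2 with h | h
        · exact absurd (hd.symm.trans h.1) (by decide)
        · exact h.2
      have e2 := Finset.card_filter_add_card_filter_not (s := outN L.Adj v)
        (fun u => IsLeafy L u)
      rw [← e1, hd] at e2
      by_cases hv3 : (outN O v).card = 3
      · exact Or.inl hv3
      right
      obtain ⟨m, hm⟩ := hv
      have hv1 : (outN O v).card = 1 := by omega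
      obtain ⟨a, ha⟩ := Finset.card_eq_one.1 hv1
      obtain ⟨v₁, v₂, hv12, hvv⟩ := Finset.card_eq_two.1
        (show ((outN L.Adj v).filter (fun u => IsLeafy L u)).card = 2 by omega)
      have m1 : L.Adj v v₁ ∧ IsLeafy L v₁ := by
        have : v₁ ∈ (outN L.Adj v).filter (fun u => IsLeafy L u) := by rw [hvv]; simp
        simpa using this
      have m2 : L.Adj v v₂ ∧ IsLeafy L v₂ := by
        have : v₂ ∈ (outN L.Adj v).filter (fun u => IsLeafy L u) := by rw [hvv]; simp
        simpa using this
      have hva : L.Adj v a := by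
        have : a ∈ outN O v := by rw [ha]; simp
        rw [e1] at this
        simpa using (Finset.mem_filter.1 this).1
      obtain ⟨w₁, hw₁, hd₁⟩ := m1.2.2
      obtain ⟨w₂, hw₂, hd₂⟩ := m2.2.2
      have leaf : ∀ w p q, (outN L.Adj w).card = 1 → L.Adj p w → L.Adj q w → p = q := by
        intro w p q hw hp hq
        refine Finset.card_le_one.1 (show (outN L.Adj w).card ≤ 1 by rw [hw]) p ?_ q ?_
        · rw [mem_outN]; exact hp.symm
        · rw [mem_outN]; exact hq.symm
      have hzw₁ : v ≠ w₁ := by rintro rfl; omega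
      have hzw₂ : v ≠ w₂ := by rintro rfl; omega
      have two : ∀ u w, IsLeafy L u → L.Adj v u → L.Adj u w → v ≠ w →
          ∀ t, O u t ↔ t = v ∨ t = w := by
        intro u w hu hvu huw hne t
        have : {v, w} = outN L.Adj u := by
          refine Finset.eq_of_subset_of_card_le ?_ ?_
          · intro x hx
            simp only [Finset.mem_insert, Finset.mem_singleton] at hx
            rw [mem_outN]
            rcases hx with rfl | rfl
            · exact hvu.symm
            · exact huw
          · rw [Finset.card_pair hne, hu.1]
        rw [hleafy k u hu, ← hL, ← mem_outN (R := L.Adj), ← this]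
        simp
      refine ⟨a, v₁, w₁, v₂, w₂, ?_, two v₁ w₁ m1.2 m1.1 hw₁ hzw₁, two v₂ w₂ m2.2 m2.1 hw₂ hzw₂,
        hv12, ?_, ?_, ?_, hzw₁, hzw₂⟩
      · intro u
        rw [← mem_outN (R := O), ha]; simp
      · rintro rfl
        exact hv12 (leaf w₁ v₁ v₂ hd₁ hw₁ hw₂)
      · rintro rfl
        exact L.ne_of_adj m1.1 (leaf a v v₁ hd₁ hva hw₁)
      · rintro rfl
        exact L.ne_of_adj m2.1 (leaf a v v₂ hd₂ hva hw₂)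

theorem FourColorable.locallyIrregularColorable (h : FourColorable G) :
    G.LocallyIrregularColorable 4 := by
  obtain ⟨f, hf, hk⟩ := h
  set c : G.EdgeLabeling (Fin 4) :=
    SimpleGraph.EdgeLabeling.mk (fun u v _ => f u v) (fun u v h => (hf u v h).symm)
  have hadj : ∀ k u v, (c.labelGraph k).Adj u v ↔ G.Adj u v ∧ f u v = k := by
    intro k u v
    rw [SimpleGraph.EdgeLabeling.labelGraph_adj]
    exact ⟨fun ⟨h, e⟩ => ⟨h, e⟩, fun ⟨h, e⟩ => ⟨h, e⟩⟩
  refine ⟨c, fun k u v huv => ?_⟩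
  have hcard : ∀ v, outN (c.labelGraph k).Adj v =
      arcNeighbors (fun u v => G.Adj u v ∧ f u v = k) v := by
    intro v
    ext w
    rw [mem_outN, mem_arcNeighbors, hadj]
    refine ⟨Or.inl, ?_⟩
    rintro (h | h)
    · exact h
    · exact ⟨h.1.symm, by rw [← h.2]; exact hf _ _ h.1.symm⟩
  have := hk k ((hadj k u v).1 huv)
  rw [← hcard, ← hcard, card_outN_adj, card_outN_adj] at this
  convert this

end Initial

theorem theorem4 {V : Type*} [Fintype V] (G : SimpleGraph V) [DecidableRel G.Adj]
    (hdeg : G.maxDegree ≤ 3) (hdec : G.IsDecomposable) :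
    G.LocallyIrregularColorable 4 ∧ G.locallyIrregularChromaticIndex ≤ 4 := by
  obtain ⟨k, c, hc⟩ := hdec
  obtain ⟨O, hO⟩ := exists_goodOrientation (G := G) (by
    intro v
    rw [card_outN_adj]
    exact (G.degree_le_maxDegree v).trans hdeg) c hc
  obtain ⟨O', hO', hsep⟩ := IsGoodOrientation.exists_separated _ O hO le_rfl
  have h4 := (hO'.fourColorable hsep).locallyIrregularColorable
  exact ⟨h4, iInf₂_le 4 h4⟩
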